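/- **Theorem 3.3.** *Setting.* A data collector $\mathcal X$ interacts, by means of instances of a protocol $\pi$ and a deletion protocol $\pi_D$, with an environment $\mathcal Z$ and a deletion-requester $\mathcal Y$. Both may be randomized and computationally unbounded, and time is counted in activations: $\mathcal Z$ *has time $T$* if it is activated at most $T$ times, and $\mathcal Y$ *has time $T$* if it is activated at most $T$ times in a row whenever $\mathcal Z$ activates it (so every machine making at most $T$ steps has time $T$). On an activation $\mathcal Z$ may open a session of $\pi$ or $\pi_D$ with $\mathcal X$, send an arbitrary message to the server of one of its sessions (it need not follow the protocol), activate $\mathcal X$, activate $\mathcal Y$ (possibly with a message), or end the alive phase. $\mathcal Y$ runs honest clients: it may start an instance of $\pi$ with an input of its choice, start an instance of $\pi_D$ for an instance of $\pi$ that it started and completed (the input being the deletion token of that instance), or give the activation back to $\mathcal Z$; it never sends anything to $\mathcal Z$. Activation is passed on by writing on a tape (an output or input tape or the tape of the other party of a session), and returns to $\mathcal Z$ if a machine halts without writing. When the alive phase ends, $\pi_D$ is run for every completed instance of $\pi$ started by $\mathcal Y$ for which this has not been done. In the *ideal* execution $\mathcal Y$ is replaced by a silent requester. $\mathcal Y$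 is *$1$-representative* if it initiates at most one instance of $\pi$ with $\mathcal X$. For a security parameter $\lambda$, the *$1$-representative statistical deletion-compliance error of $\mathcal X$ against time $T$* is the supremum, over all $\mathcal Z$ and all $1$-representative $\mathcal Y$ with time $T$ and all unbounded distinguishers $D$, of $$\bigl|\Pr[D(\mathsf{state}^R_{\mathcal X},\mathsf{view}^R_{\mathcal Z})=1]-\Pr[D(\mathsf{state}^I_{\mathcal X},\mathsf{view}^I_{\mathcal Z})=1]\bigr| ,$$ where $R$ and $I$ refer to the end of the real and of the ideal execution, $\mathsf{state}_{\mathcal X}$ is the memory of $\mathcal X$, and $\mathsf{view}_{\mathcal Z}$ consists of the randomness of $\mathcal Z$ and everything it has received. *The collector.* Let $\mathsf{summarize}$ be a randomized algorithm with discrete output that takes tuples $x=(x_1,\dots,x_n)$ of data values, for all $n$. Let $\varepsilon:\mathbb N\to[0,1]$. The algorithm is *$\varepsilon$-differentially private* if for all $n$, all $n$-tuples $x,x'$ that differ in at most one location and all sets $S$ of outputs, $\Pr[\mathsf{summarize}(x)\in S]\le e^{\varepsilon(n)}\Pr[\mathsf{summarize}(x')\in S]$. For each $\lambda\ge1$ let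 $\mathsf{Dict}$ be an implementation of a dictionary (insertion, which does nothing if the key is in use; lookup; deletion) with keys in $\{0,1\}^\lambda$, which is *history-independent*: any two sequences of operations producing the same content (i.e. such that any further sequence of operations returns the same results after either) induce the same distribution of the memory representation. The collector $\mathcal X$ stores $\mathsf{Dict}$, initially empty, a threshold $thr$ drawn uniformly from $\{\lambda+1,\dots,2\lambda\}$, $count=0$, $summarized=\mathsf{false}$ and $summary=\bot$, and nothing else, and works as follows. * Protocol $\pi$: the client sends a value $v$. $\mathcal X$ draws $key\in\{0,1\}^\lambda$ uniformly and inserts $v$ under $key$. If a new entry was actually inserted, it increments $count$ and, if $summarized=\mathsf{true}$, also $thr$. Then, if $count=thr$ and $summarized=\mathsf{false}$, it draws a uniformly random set of $\lambda$ stored entries, applies $\mathsf{summarize}$ to the tuple of their values listed in a uniformly random order, stores the output in $summary$ and sets $summarized=\mathsf{true}$. Finally it sends $key$ to the client; $key$ is the client's output and the deletion token of the instance. * Protocol $\pi_D$: the client sends a key. $\mathcal X$ deletes the entry under this key, if any. If an entry was actually deleted, it decrements $count$ and, if $summarized=\mathsf{true}$, also $thr$. There is no answer. *Claim.* For every polynomial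 $q$ there is a polynomial $p$, depending only on $q$, such that for every $\varepsilon$-differentially private $\mathsf{summarize}$, all history-independent dictionaries as above and every security parameter $\lambda\ge1$, the $1$-representative statistical deletion-compliance error of $(\mathcal X,\pi,\pi_D)$ against time $q(\lambda)$ is at most $$\varepsilon(\lambda)+\frac1\lambda+\frac{p(\lambda)}{2^\lambda}.$$ -/

import Mathlib

open scoped ENNReal

noncomputable section

namespace DeletionCompliance

/-! ### Data collectors, environments, deletion-requesters and their executions

All machines share one alphabet `M` of messages (tape contents). Machines are modelled by their
input/output behaviour on activations: a machine is not required to be computable, and the time it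
is given is counted in activations. As one activation costs at least one step, every interactive
Turing machine that makes at most `T` steps is a machine with time `T` in this sense. -/

/-- A two-party protocol with one message from the client-side machine to the server-side machine
and possibly one answer.
* `clientSend x`: the message sent by the honest client on input `x` (`none`: the input does not have
  the required format and the client halts);
* `serverOutput m`: what the server writes on its output tape, for the data collector to read, on the
  first message `m` from the client (`none`: the message is malformed and the server halts);
* `serverReply r`: the message the server sends to the client once the collector has written `r` on
  its input tape;
* `clientOutput a`: what the honest client writes on its output tape on the answer `a`. -/
structure Protocol (M : Type) where
  clientSend : M → Option M
  serverOutput : M → Option M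
  serverReply : M → M
  clientOutput : M → M

/-- A data collector `(X, π, π_D)`. `State` is the type of contents of the work tape of `X` when it
is not active, `handle o s` is the activation of `X` on which it reads `o` on the output tape of a
server that it controls and possibly writes on the input tape of that server, `idle` is an activation
with no unread output. `token m a` is the deletion token of an instance of `π` with transcript
`(m, a)`. -/
structure DataCollector (M : Type) where
  State : Type
  start : PMF State
  handle : M → State → PMF (State × Option M)
  idle : State → PMF State
  mainProtocol : Protocol M
  deletionProtocol : Protocol M
  token : M → M → M

/-- Which of the two protocols a session runs. -/
inductive Kind
  | main
  | deletion

/-- What the environment can do on an activation: create a session of `π` or `π_D`; let the client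
side of its `i`-th session send `m` to the server; activate the collector; activate the
deletion-requester, possibly writing a message on its incoming tape; end the alive phase.
The environment may use arbitrary machines as the clients of its sessions; they are regarded as parts
of the environment, so that it decides itself when they send which message. -/
inductive EnvAction (M : Type)
  | openSession (κ : Kind)
  | send (i : ℕ) (m : M)
  | wakeCollector
  | wakeRequester (w : Option (List Bool))
  | endAlive

/-- What the environment sees when it is activated again: nothing, or the message `m` that the client
side of its `i`-th session received from the server. -/
inductive EnvEvent (M : Type)
  | silent
  | received (i : ℕ) (m : M)

/-- An environment: the distribution of its randomness tape, and its next action as a function of its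
randomness and of everything seen so far (most recent event first). -/
structure Environment (M : Type) where
  Coins : Type
  coins : PMF Coins
  next : Coins → List (EnvEvent M) → EnvAction M

/-- What the deletion-requester can do on an activation: start a new instance of `π` whose honest
client gets input `x`; start an instance of `π_D` for the `i`-th instance of `π` that it has started,
with the deletion token of that instance as the input of the honest client; halt. (Writing again on
the input tape of an honest client that has already run merely gives the activation back to the
environment, as `halt` does.) -/
inductive ReqAction (M : Type)
  | initiate (x : M)
  | delete (i : ℕ)
  | halt

/-- What the deletion-requester sees when activated: an activation by the environment, possibly with
a message, or an output of the client that it has just run. -/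
inductive ReqEvent (M : Type)
  | woken (w : Option (List Bool))
  | output (m : M)

/-- A deletion-requester. -/
structure Requester (M : Type) where
  Coins : Type
  coins : PMF Coins
  next : Coins → List (ReqEvent M) → ReqAction M

/-- The silent deletion-requester, which halts whenever it is activated. -/
def Requester.silent (M : Type) : Requester M where
  Coins := Unit
  coins := PMF.pure ()
  next := fun _ _ => ReqAction.halt

/-- The record of an instance of `π` started by the deletion-requester: its deletion token if the
instance was run to completion, and whether an instance of `π_D` was started for it. -/
structure Instance (M : Type) where
  token : Option M
  requested : Bool

variable {M : Type}

/-- The execution at a point at which the environment or the deletion-requester is active: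
the state of the collector, the events seen by the environment, its sessions (with a flag telling
whether the server of the session has already received its message), the events seen by the
deletion-requester, the instances of `π` that it has started. -/
structure Config (C : DataCollector M) where
  state : C.State
  envLog : List (EnvEvent M)
  sessions : List (Kind × Bool)
  reqLog : List (ReqEvent M)
  instances : List (Instance M)

namespace DataCollector

variable (C : DataCollector M)

/-- The protocol run in a session. -/
def protocol : Kind → Protocol M
  | Kind.main => C.mainProtocol
  | Kind.deletion => C.deletionProtocol

/-- The server of a fresh session of `P` receives `m`. It writes on its output tape, which activates
the collector; if the collector answers on the input tape of the server, the server is activated and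
sends a message to the client, which is returned. -/
def serve (P : Protocol M) (m : M) (s : C.State) : PMF (C.State × Option M) :=
  match P.serverOutput m with
  | none => pure (s, none)
  | some o => do
      let (s', r) ← C.handle o s
      pure (s', r.map P.serverReply)

/-- An instance of `P` whose client is honest and has input `x`: the transcript (message sent,
answer) is returned if an answer arrives. -/
def runHonest (P : Protocol M) (x : M) (s : C.State) : PMF (C.State × Option (M × M)) :=
  match P.clientSend x with
  | none => pure (s, none)
  | some m => do
      let (s', r) ← C.serve P m s
      pure (s', r.map fun a => (m, a))

/-- The deletion-requester (with randomness `y`) is active, for at most `T` consecutive activations.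
If a client that it runs gives an output, the deletion-requester is activated again; otherwise the
environment is activated next. -/
def runRequester (Y : Requester M) (y : Y.Coins) : ℕ → Config C → PMF (Config C)
  | 0, c => pure c
  | T + 1, c =>
    match Y.next y c.reqLog with
    | ReqAction.halt => pure c
    | ReqAction.initiate x => do
        let (s, tr) ← C.runHonest C.mainProtocol x c.state
        match tr with
        | none => pure { c with state := s, instances := c.instances ++ [⟨none, false⟩] }
        | some (m, a) =>
            runRequester Y y T
              { c with
                state := s
                reqLog := ReqEvent.output (C.mainProtocol.clientOutput a) :: c.reqLog
                instances := c.instances ++ [⟨some (C.token m a), false⟩] }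
    | ReqAction.delete i =>
        match c.instances[i]? with
        | some ⟨some t, _⟩ => do
            let (s, tr) ← C.runHonest C.deletionProtocol t c.state
            let c' : Config C :=
              { c with state := s, instances := c.instances.set i ⟨some t, true⟩ }
            match tr with
            | none => pure c'
            | some (_, a) =>
                runRequester Y y T
                  { c' with
                    reqLog := ReqEvent.output (C.deletionProtocol.clientOutput a) :: c'.reqLog }
        | _ => pure c

/-- The alive phase, with at most `k` further activations of the environment; `T` bounds the number
of activations of the deletion-requester each time that the environment activates it. -/
def runAlive (Z : Environment M) (z : Z.Coins) (Y : Requester M) (y : Y.Coins) (T : ℕ) :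
    ℕ → Config C → PMF (Config C)
  | 0, c => pure c
  | k + 1, c =>
    match Z.next z c.envLog with
    | EnvAction.endAlive => pure c
    | EnvAction.openSession κ =>
        runAlive Z z Y y T k
          { c with
            envLog := EnvEvent.silent :: c.envLog
            sessions := c.sessions ++ [(κ, false)] }
    | EnvAction.send i m =>
        match c.sessions[i]? with
        | some (κ, false) => do
            let (s, r) ← C.serve (C.protocol κ) m c.state
            let e : EnvEvent M :=
              match r with
              | none => EnvEvent.silent
              | some a => EnvEvent.received i a
            runAlive Z z Y y T k
              { c with
                state := s
                envLog := e :: c.envLog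
                sessions := c.sessions.set i (κ, true) }
        | _ => runAlive Z z Y y T k { c with envLog := EnvEvent.silent :: c.envLog }
    | EnvAction.wakeCollector => do
        let s ← C.idle c.state
        runAlive Z z Y y T k { c with state := s, envLog := EnvEvent.silent :: c.envLog }
    | EnvAction.wakeRequester w => do
        let c' ← C.runRequester Y y T { c with reqLog := ReqEvent.woken w :: c.reqLog }
        runAlive Z z Y y T k { c' with envLog := EnvEvent.silent :: c'.envLog }

/-- The terminate phase: for each completed instance of `π` started by the deletion-requester for
which no instance of `π_D` was started yet, such an instance is run. (The instances of the alive
phase have all come to an end by then.) -/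
def terminate : List (Instance M) → C.State → PMF C.State
  | [], s => pure s
  | ⟨some t, false⟩ :: l, s => do
      let (s', _) ← C.runHonest C.deletionProtocol t s
      terminate l s'
  | _ :: l, s => terminate l s

/-- The complete execution, in which `Z` and `Y` have time `T`: the randomness of the environment and
the final configuration. -/
def run (Z : Environment M) (Y : Requester M) (T : ℕ) : PMF (Z.Coins × Config C) := do
  let z ← Z.coins
  let y ← Y.coins
  let s ← C.start
  let c ← C.runAlive Z z Y y T T ⟨s, [], [], [], []⟩
  let s' ← C.terminate c.instances c.state
  pure (z, { c with state := s' })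

/-- The state of the collector and the view of the environment (its randomness and everything it
has received) at the end of the execution. -/
def exec (Z : Environment M) (Y : Requester M) (T : ℕ) :
    PMF (C.State × (Z.Coins × List (EnvEvent M))) :=
  (C.run Z Y T).map fun r => (r.2.state, (r.1, r.2.envLog))

/-- `Y` (with time `T`) is `k`-representative: when interacting with the collector, it initiates at
most `k` instances of `π`. -/
def IsRepresentative (k : ℕ) (Y : Requester M) (T : ℕ) : Prop :=
  ∀ Z : Environment M, ∀ r ∈ (C.run Z Y T).support, r.2.instances.length ≤ k

end DataCollector

/-- The advantage of a (randomized, unbounded) distinguisher `D` between two distributions. -/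
def advantage {α : Type} (P Q : PMF α) (D : α → PMF Bool) : ℝ :=
  |((P.bind D) true).toReal - ((Q.bind D) true).toReal|

/-- The `k`-representative statistical deletion-compliance error of a collector (for one value of the
security parameter) against environments and deletion-requesters with time `T`: the supremum of the
advantages of distinguishers between the real execution and the ideal one, in which the
deletion-requester is silent. -/
def DataCollector.complianceError (C : DataCollector M) (k T : ℕ) : ℝ :=
  sSup {r : ℝ | ∃ (Z : Environment M) (Y : Requester M)
    (D : C.State × (Z.Coins × List (EnvEvent M)) → PMF Bool),
      C.IsRepresentative k Y T ∧
      r = advantage (C.exec Z Y T) (C.exec Z (Requester.silent M) T) D}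

/-! ### History-independent dictionaries -/

/-- The operations of a dictionary. -/
inductive DictOp (K V : Type)
  | insert (key : K) (value : V)
  | lookup (key : K)
  | delete (key : K)

/-- The results of the operations: whether an entry was actually inserted or deleted, and the value
found by a lookup. -/
inductive DictResult (V : Type)
  | inserted (b : Bool)
  | found (o : Option V)
  | deleted (b : Bool)

section Dictionary

variable {K V : Type} [DecidableEq K]

/-- The abstract dictionary: the effect of an operation on the stored key-value pairs. -/
def dictStep (d : K → Option V) : DictOp K V → (K → Option V) × DictResult V
  | DictOp.insert k v =>
      match d k with
      | none => (Function.update d k (some v), DictResult.inserted true)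
      | some _ => (d, DictResult.inserted false)
  | DictOp.lookup k => (d, DictResult.found (d k))
  | DictOp.delete k =>
      match d k with
      | none => (d, DictResult.deleted false)
      | some _ => (Function.update d k none, DictResult.deleted true)

/-- The abstract dictionary after a sequence of operations. -/
def dictAfter (d : K → Option V) (S : List (DictOp K V)) : K → Option V :=
  S.foldl (fun d op => (dictStep d op).1) d

/-- The results returned by a sequence of operations. -/
def dictResults : (K → Option V) → List (DictOp K V) → List (DictResult V)
  | _, [] => []
  | d, op :: S => (dictStep d op).2 :: dictResults (dictStep d op).1 S

/-- Two sequences of operations on an empty dictionary produce the same content if every further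
sequence returns the same results after either of them. -/
def SameContent (S₁ S₂ : List (DictOp K V)) : Prop :=
  ∀ T : List (DictOp K V),
    dictResults (dictAfter (fun _ => none) S₁) T = dictResults (dictAfter (fun _ => none) S₂) T

end Dictionary

/-- A randomized implementation: the memory representations, the initial memory, the execution of an
operation, and the way in which the stored entries are read off the memory. -/
structure DictImpl (K V : Type) where
  Mem : Type
  start : PMF Mem
  step : DictOp K V → Mem → PMF (Mem × DictResult V)
  entries : Mem → K → Option V

namespace DictImpl

variable {K V : Type} [DecidableEq K] (I : DictImpl K V)

/-- Execution of a sequence of operations from a given memory. -/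
def runFrom : List (DictOp K V) → I.Mem → PMF (I.Mem × List (DictResult V))
  | [], m => pure (m, [])
  | op :: S, m => do
      let (m', r) ← I.step op m
      let (m'', rs) ← runFrom S m'
      pure (m'', r :: rs)

/-- Execution of a sequence of operations from the initial memory. -/
def run (S : List (DictOp K V)) : PMF (I.Mem × List (DictResult V)) :=
  I.start.bind (I.runFrom S)

/-- The implementation implements a dictionary. -/
def IsDictionary : Prop :=
  ∀ S : List (DictOp K V), ∀ p ∈ (I.run S).support,
    p.2 = dictResults (fun _ => none) S ∧ I.entries p.1 = dictAfter (fun _ => none) S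

/-- History independence: sequences of operations that produce the same content induce the same
distribution of the memory representation. -/
def HistoryIndependent : Prop :=
  ∀ S₁ S₂ : List (DictOp K V), SameContent S₁ S₂ →
    (I.run S₁).map Prod.fst = (I.run S₂).map Prod.fst

end DictImpl

/-! ### Differential privacy and the data collector -/

/-- `ε`-differential privacy of a randomized algorithm on tuples. -/
def IsDifferentiallyPrivate {V Out : Type} (A : (n : ℕ) → (Fin n → V) → PMF Out) (ε : ℕ → ℝ) :
    Prop :=
  ∀ (n : ℕ) (x x' : Fin n → V), {i | x i ≠ x' i}.Subsingleton → ∀ S : Set Out,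
    (A n x).toOuterMeasure S ≤ ENNReal.ofReal (Real.exp (ε n)) * (A n x').toOuterMeasure S

/-- The keys `{0,1}^n`. -/
abbrev Key (n : ℕ) : Type := Fin n → Bool

/-- The messages of the summarizing data collector. -/
inductive DPMessage (V : Type) (n : ℕ)
  | value (v : V)
  | key (k : Key n)
  | insert (v : V)
  | delete (k : Key n)

/-- The state of the summarizing data collector. -/
structure DPState {V : Type} {n : ℕ} (I : DictImpl (Key n) V) (Out : Type) where
  mem : I.Mem
  thr : ℕ
  count : ℕ
  summarized : Bool
  summary : Option Out

section DPCollector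

variable {V Out : Type} {n : ℕ}

/-- The keys under which something is stored. -/
abbrev StoredKey (I : DictImpl (Key n) V) (m : I.Mem) : Type :=
  {k : Key n // (I.entries m k).isSome = true}

open Classical in
/-- A uniformly random tuple of `n` distinct entries of the dictionary is drawn, that is, a uniformly
random set of `n` entries, listed in a random order, and the values are given to the algorithm.
(There are more than `n` entries whenever the collector uses this.) -/
def sampleSummary (summarize : (k : ℕ) → (Fin k → V) → PMF Out) (I : DictImpl (Key n) V)
    (m : I.Mem) : PMF (Option Out) :=
  if h : Nonempty (Fin n ↪ StoredKey I m) then do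
    let S ← @PMF.uniformOfFintype (Fin n ↪ StoredKey I m) inferInstance h
    let out ← summarize n fun i => (I.entries m (S i).1).get (S i).2
    pure (some out)
  else pure none

/-- Compute the summary if it is time to do so. -/
def maybeSummarize (summarize : (k : ℕ) → (Fin k → V) → PMF Out) (I : DictImpl (Key n) V)
    (s : DPState I Out) : PMF (DPState I Out) :=
  if s.count = s.thr ∧ s.summarized = false then do
    let out ← sampleSummary summarize I s.mem
    pure { s with summary := out, summarized := true }
  else pure s

/-- The collector reads `(insert, v)`. -/
def dpInsert (summarize : (k : ℕ) → (Fin k → V) → PMF Out) (I : DictImpl (Key n) V) (v : V)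
    (s : DPState I Out) : PMF (DPState I Out × Option (DPMessage V n)) := do
  let k ← PMF.uniformOfFintype (Key n)
  let (m, res) ← I.step (DictOp.insert k v) s.mem
  let s₁ : DPState I Out :=
    match res with
    | DictResult.inserted true =>
        { s with
          mem := m
          count := s.count + 1
          thr := if s.summarized then s.thr + 1 else s.thr }
    | _ => { s with mem := m }
  let s₂ ← maybeSummarize summarize I s₁
  pure (s₂, some (DPMessage.key k))

/-- The collector reads `(delete, k)`. -/
def dpDelete (I : DictImpl (Key n) V) (k : Key n) (s : DPState I Out) :
    PMF (DPState I Out × Option (DPMessage V n)) := do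
  let (m, res) ← I.step (DictOp.delete k) s.mem
  let s₁ : DPState I Out :=
    match res with
    | DictResult.deleted true =>
        { s with
          mem := m
          count := s.count - 1
          thr := if s.summarized then s.thr - 1 else s.thr }
    | _ => { s with mem := m }
  pure (s₁, none)

/-- The protocol `π`: the client sends its value, the server outputs `(insert, value)`, and the key
chosen by the collector is sent back and output by the client. -/
def dpMainProtocol (V : Type) (n : ℕ) : Protocol (DPMessage V n) where
  clientSend := fun x => match x with
    | DPMessage.value v => some (DPMessage.value v)
    | _ => none
  serverOutput := fun m => match m with
    | DPMessage.value v => some (DPMessage.insert v)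
    | _ => none
  serverReply := id
  clientOutput := id

/-- The protocol `π_D`: the client sends its key and the server outputs `(delete, key)`. -/
def dpDeletionProtocol (V : Type) (n : ℕ) : Protocol (DPMessage V n) where
  clientSend := fun x => match x with
    | DPMessage.key k => some (DPMessage.key k)
    | _ => none
  serverOutput := fun m => match m with
    | DPMessage.key k => some (DPMessage.delete k)
    | _ => none
  serverReply := id
  clientOutput := id

/-- The data collector with security parameter `n`, which computes a summary when the number of
stored points reaches a threshold that is uniformly random in `{n + 1, ..., 2 * n}`. -/
def dpCollector (summarize : (k : ℕ) → (Fin k → V) → PMF Out) (n : ℕ+) (I : DictImpl (Key n) V) :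
    DataCollector (DPMessage V n) where
  State := DPState I Out
  start := do
    let m ← I.start
    let thr ← PMF.uniformOfFinset (Finset.Icc ((n : ℕ) + 1) (2 * (n : ℕ)))
      (Finset.nonempty_Icc.mpr (by have := n.pos; omega))
    pure ⟨m, thr, 0, false, none⟩
  handle := fun o s => match o with
    | DPMessage.insert v => dpInsert summarize I v s
    | DPMessage.delete k => dpDelete I k s
    | _ => pure (s, none)
  idle := fun s => pure s
  mainProtocol := dpMainProtocol V n
  deletionProtocol := dpDeletionProtocol V n
  token := fun _ a => a

end DPCollector

end DeletionCompliance

end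

open DeletionCompliance

/-! The answer of the collector to an insertion is the key it has drawn, whether or not the entry
was stored, and a deletion has no answer. Hence the view of `Z` is a function of its coins and of
the keys drawn for it; it depends neither on the memory nor on `Y`, which never talks to `Z`. So all
keys can be drawn beforehand: a tape with one key per activation of `Z`, and one further key `k` for
the single instance of `Y` (`Executes.exec_eq`). With coins and keys fixed, the view is the same in
both executions, and the ideal one performs a fixed list `S` of dictionary operations, while the
real one performs a list `L` that is `S` with nothing added, or with an insertion under `k` and
later at least one deletion of `k` (`withVisitor_weave`). What remains is to compare the laws of the
final state for `L` and `S`.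

The list `S` has at most `T` operations and is independent of `k`, so some operation of `S` refers
to `k` with probability at most `T / 2 ^ n`. Otherwise both lists end with the same content, and by
history independence with the same law of the memory. Given the operations, memory and summary are
independent, and the summary depends only on the first content whose size is the initial threshold
`θ` (`start_bind_runOps`).

Let `A` be the largest size reached before the insertion under `k`, and `B` the larger of `A` and
the largest size that `S` reaches between this insertion and the first deletion of `k`. For `θ ≤ A`
and for `θ > B + 1` both lists give the same first hit. For `A < θ ≤ B` the first hit of `L` at `θ +
1` is that of `S` at `θ` plus the entry of `Y` (`WithVisitor.compare`). Pairing `θ + 1` in the real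
execution with `θ` in the ideal one matches all but at most one of the `n` thresholds, which costs
`1 / n` (`sum_Icc_le_of_shift`). In a shifted pair the summaries are computed on random tuples from
contents that differ by one entry. Replacing that entry, if it was drawn, by a random unused one
couples the two samples so that they differ in at most one position, and privacy gives the factor
`exp ε`, hence an additive error `ε` (`expect_summarizeContent_update`, `le_add_of_le_exp_mul`). -/

noncomputable section

namespace DeletionCompliance

/-! ### Expectations of nonnegative functions -/

/-- The expectation of a nonnegative function under a discrete distribution. -/
def expect {α : Type*} (P : PMF α) (f : α → ℝ≥0∞) : ℝ≥0∞ := ∑' a, P a * f a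

section Expect

variable {α β : Type*}

theorem expect_pure (a : α) (f : α → ℝ≥0∞) : expect (PMF.pure a) f = f a := by
  unfold expect
  rw [tsum_eq_single a]
  · simp
  · intro b hb
    simp [hb]

theorem expect_bind (P : PMF α) (Q : α → PMF β) (f : β → ℝ≥0∞) :
    expect (P.bind Q) f = expect P fun a => expect (Q a) f := by
  simp only [expect, PMF.bind_apply, ← ENNReal.tsum_mul_right, ← ENNReal.tsum_mul_left]
  rw [ENNReal.tsum_comm]
  simp only [mul_assoc]

theorem expect_mono {P : PMF α} {f g : α → ℝ≥0∞} (h : ∀ a, f a ≤ g a) :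
    expect P f ≤ expect P g :=
  ENNReal.tsum_le_tsum fun a => mul_le_mul_right (h a) _

theorem expect_const (P : PMF α) (c : ℝ≥0∞) : expect P (fun _ => c) = c := by
  simp [expect, ENNReal.tsum_mul_right, P.tsum_coe]

theorem expect_add (P : PMF α) (f g : α → ℝ≥0∞) :
    expect P (fun a => f a + g a) = expect P f + expect P g := by
  simp [expect, mul_add, ENNReal.tsum_add]

theorem expect_mul_left (P : PMF α) (c : ℝ≥0∞) (f : α → ℝ≥0∞) :
    expect P (fun a => c * f a) = c * expect P f := by
  simp only [expect, ← ENNReal.tsum_mul_left]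
  exact tsum_congr fun a => by ring

theorem expect_le_one {P : PMF α} {f : α → ℝ≥0∞} (h : ∀ a, f a ≤ 1) : expect P f ≤ 1 :=
  (expect_mono h).trans (expect_const P 1).le

theorem expect_congr_support {P : PMF α} {f g : α → ℝ≥0∞} (h : ∀ a ∈ P.support, f a = g a) :
    expect P f = expect P g := by
  refine tsum_congr fun a => ?_
  by_cases ha : a ∈ P.support
  · rw [h a ha]
  · rw [PMF.mem_support_iff, not_not] at ha
    simp [ha]

theorem expect_comm (P : PMF α) (Q : PMF β) (f : α → β → ℝ≥0∞) :
    expect P (fun a => expect Q (f a)) = expect Q fun b => expect P fun a => f a b := by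
  simp only [expect, ← ENNReal.tsum_mul_left]
  rw [ENNReal.tsum_comm]
  exact tsum_congr fun b => tsum_congr fun a => by ring

theorem expect_mono_support {P : PMF α} {f g : α → ℝ≥0∞}
    (h : ∀ a ∈ P.support, f a ≤ g a) : expect P f ≤ expect P g := by
  refine ENNReal.tsum_le_tsum fun a => ?_
  by_cases ha : a ∈ P.support
  · exact mul_le_mul_right (h a ha) _
  · rw [PMF.mem_support_iff, not_not] at ha
    simp [ha]

theorem expect_uniformOfFintype [Fintype α] [Nonempty α] (f : α → ℝ≥0∞) :
    expect (PMF.uniformOfFintype α) f = (Fintype.card α : ℝ≥0∞)⁻¹ * ∑ a, f a := by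
  simp [expect, tsum_fintype, Finset.mul_sum]

theorem expect_uniformOfFinset (s : Finset α) (hs : s.Nonempty) (f : α → ℝ≥0∞) :
    expect (PMF.uniformOfFinset s hs) f = (s.card : ℝ≥0∞)⁻¹ * ∑ a ∈ s, f a := by
  rw [expect, tsum_eq_sum (s := s), Finset.mul_sum]
  · refine Finset.sum_congr rfl fun a ha => ?_
    rw [PMF.uniformOfFinset_apply_of_mem _ ha]
  · intro a ha
    rw [PMF.uniformOfFinset_apply_of_notMem _ ha, zero_mul]

/-- Binds agree if the kernels agree on the support. -/
theorem bind_congr_support {P : PMF α} {Q R : α → PMF β} (h : ∀ a ∈ P.support, Q a = R a) :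
    P.bind Q = P.bind R := by
  ext b
  simp only [PMF.bind_apply]
  refine tsum_congr fun a => ?_
  by_cases ha : a ∈ P.support
  · rw [h a ha]
  · rw [PMF.mem_support_iff, not_not] at ha
    simp [ha]

/-- A one-sided comparison of expectations of all `[0,1]`-valued functions bounds the advantage of
all distinguishers. -/
theorem advantage_le {α : Type} {P Q : PMF α} {δ : ℝ} (hδ : 0 ≤ δ)
    (h : ∀ f : α → ℝ≥0∞, (∀ a, f a ≤ 1) → expect P f ≤ expect Q f + ENNReal.ofReal δ)
    (D : α → PMF Bool) : advantage P Q D ≤ δ := by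
  -- The hypothesis is used for both answers of `D`: as the two probabilities sum to one, the bound
  -- for `false` is the reverse inequality for `true`.
  have key : ∀ b, ((P.bind D) b).toReal ≤ ((Q.bind D) b).toReal + δ := by
    intro b
    have h1 := h (fun a => D a b) fun a => PMF.coe_le_one _ _
    have h2 : (P.bind D) b ≤ (Q.bind D) b + ENNReal.ofReal δ := by
      simpa only [PMF.bind_apply, expect] using h1
    have h3 := ENNReal.toReal_mono
      (ENNReal.add_ne_top.mpr ⟨PMF.apply_ne_top _ _, ENNReal.ofReal_ne_top⟩) h2
    rwa [ENNReal.toReal_add (PMF.apply_ne_top _ _) ENNReal.ofReal_ne_top,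
      ENNReal.toReal_ofReal hδ] at h3
  have total : ∀ R : PMF Bool, (R true).toReal + (R false).toReal = 1 := by
    intro R
    have h1 := R.tsum_coe
    rw [tsum_bool, add_comm] at h1
    rw [← ENNReal.toReal_add (PMF.apply_ne_top _ _) (PMF.apply_ne_top _ _), h1,
      ENNReal.toReal_one]
  have h1 := key true
  have h2 := key false
  have h3 := total (P.bind D)
  have h4 := total (Q.bind D)
  rw [advantage, abs_le]
  constructor <;> linarith

end Expect

/-! ### The number of stored entries along a sequence of dictionary operations -/

/-- The key that a dictionary operation refers to. -/
def DictOp.target {K V : Type} : DictOp K V → K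
  | DictOp.insert k _ => k
  | DictOp.lookup k => k
  | DictOp.delete k => k

/-- The number of entries of a dictionary. -/
def entryCount {K V : Type} [Fintype K] (d : K → Option V) : ℕ :=
  (Finset.univ.filter fun k => (d k).isSome = true).card

theorem entryCount_empty {K V : Type} [Fintype K] :
    entryCount (fun _ : K => (none : Option V)) = 0 := by
  simp [entryCount]

section Contents

variable {K V : Type} [DecidableEq K]

theorem dictAfter_append (d : K → Option V) (S₁ S₂ : List (DictOp K V)) :
    dictAfter d (S₁ ++ S₂) = dictAfter (dictAfter d S₁) S₂ := by
  simp [dictAfter]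

theorem dictAfter_cons (d : K → Option V) (o : DictOp K V) (S : List (DictOp K V)) :
    dictAfter d (o :: S) = dictAfter (dictStep d o).1 S := rfl

/-- An operation on another key neither reads nor changes the entry under `k`, so it commutes with
setting that entry. All statements about the visitor's entry rest on this. -/
theorem dictStep_update {k : K} {o : DictOp K V} (ho : o.target ≠ k) (d : K → Option V)
    (x : Option V) :
    (dictStep (Function.update d k x) o).1 = Function.update (dictStep d o).1 k x := by
  cases o with
  | insert j v =>
    simp only [DictOp.target] at ho
    simp only [dictStep, Function.update_of_ne ho]
    cases d j with
    | none => exact Function.update_comm ho.symm _ _ _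
    | some w => rfl
  | lookup j => rfl
  | delete j =>
    simp only [DictOp.target] at ho
    simp only [dictStep, Function.update_of_ne ho]
    cases d j with
    | none => rfl
    | some w => exact Function.update_comm ho.symm _ _ _

theorem dictStep_apply_of_target_ne {k : K} {o : DictOp K V} (ho : o.target ≠ k)
    (d : K → Option V) : (dictStep d o).1 k = d k := by
  have := congrFun (dictStep_update ho d (d k)) k
  rwa [Function.update_eq_self, Function.update_self] at this

theorem dictAfter_update {k : K} {S : List (DictOp K V)} (hS : ∀ o ∈ S, o.target ≠ k)
    (d : K → Option V) (x : Option V) :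
    dictAfter (Function.update d k x) S = Function.update (dictAfter d S) k x := by
  induction S generalizing d with
  | nil => rfl
  | cons o S ih =>
    rw [dictAfter_cons, dictAfter_cons, dictStep_update (hS o (by simp)),
      ih fun o' h => hS o' (by simp [h])]

theorem dictAfter_apply_of_target_ne {k : K} {S : List (DictOp K V)}
    (hS : ∀ o ∈ S, o.target ≠ k) (d : K → Option V) : dictAfter d S k = d k := by
  have := congrFun (dictAfter_update hS d (d k)) k
  rwa [Function.update_eq_self, Function.update_self] at this

/-- `Padded k S L`: the sequence `L` arises from `S` by adding deletions of the key `k`. -/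
inductive Padded {K V : Type} (k : K) : List (DictOp K V) → List (DictOp K V) → Prop
  | nil : Padded k [] []
  | cons (o : DictOp K V) {S L : List (DictOp K V)} (h : Padded k S L) :
      Padded k (o :: S) (o :: L)
  | pad {S L : List (DictOp K V)} (h : Padded k S L) : Padded k S (DictOp.delete k :: L)

/-- Deleting an absent key has no effect, and `k` remains absent since nothing in `S` refers to it.
-/
theorem Padded.after_eq {k : K} {S L : List (DictOp K V)} (h : Padded k S L)
    (hS : ∀ o ∈ S, o.target ≠ k) {d : K → Option V} (hd : d k = none) :
    dictAfter d L = dictAfter d S := by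
  induction h generalizing d with
  | nil => rfl
  | cons o _ ih =>
    exact ih (fun o' h => hS o' (by simp [h]))
      ((dictStep_apply_of_target_ne (hS o (by simp)) d).trans hd)
  | pad _ ih =>
    rw [dictAfter_cons]
    simpa [dictStep, hd] using ih hS hd

variable [Fintype K]

theorem entryCount_update_some {d : K → Option V} {k : K} (h : d k = none) (v : V) :
    entryCount (Function.update d k (some v)) = entryCount d + 1 := by
  have : (Finset.univ.filter fun j => (Function.update d k (some v) j).isSome = true)
      = insert k (Finset.univ.filter fun j => (d j).isSome = true) := by
    ext j
    by_cases hj : j = k <;> simp [hj]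
  rw [entryCount, this, Finset.card_insert_of_notMem (by simp [h]), entryCount]

theorem entryCount_update_none {d : K → Option V} {k : K} {v : V} (h : d k = some v) :
    entryCount (Function.update d k none) + 1 = entryCount d := by
  have := entryCount_update_some (d := Function.update d k none) (k := k) (by simp) v
  rw [← this, Function.update_idem, ← h, Function.update_eq_self]

/-- Sizes cannot jump upwards over a value. This is the discrete intermediate value property that
makes the first hit of a threshold exist exactly up to the peak. -/
theorem entryCount_dictStep (d : K → Option V) (o : DictOp K V) :
    entryCount (dictStep d o).1 ≤ entryCount d + 1 := by
  cases o with
  | insert k v =>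
    simp only [dictStep]
    cases h : d k with
    | none => simp [entryCount_update_some h]
    | some w => simp
  | lookup k => simp [dictStep]
  | delete k =>
    simp only [dictStep]
    cases h : d k with
    | none => simp
    | some w =>
      have := entryCount_update_none h
      simp only
      omega

/-- The largest number of entries reached during a sequence of operations. -/
def peak (d : K → Option V) : List (DictOp K V) → ℕ
  | [] => entryCount d
  | o :: S => max (entryCount d) (peak (dictStep d o).1 S)

/-- The first content with `θ` entries reached during a sequence of operations. -/
def firstHit (θ : ℕ) (d : K → Option V) : List (DictOp K V) → Option (K → Option V)
  | [] => if entryCount d = θ then some d else none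
  | o :: S => if entryCount d = θ then some d else firstHit θ (dictStep d o).1 S

theorem entryCount_after_le_peak (d : K → Option V) (S : List (DictOp K V)) :
    entryCount (dictAfter d S) ≤ peak d S := by
  induction S generalizing d with
  | nil => simp [peak, dictAfter]
  | cons o S ih => exact (ih _).trans (le_max_right _ _)

theorem firstHit_of_entryCount_eq {θ : ℕ} {d : K → Option V} (S : List (DictOp K V))
    (h : entryCount d = θ) : firstHit θ d S = some d := by
  cases S <;> simp [firstHit, h]

theorem firstHit_append (θ : ℕ) (d : K → Option V) (S₁ S₂ : List (DictOp K V)) :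
    firstHit θ d (S₁ ++ S₂) = (firstHit θ d S₁).or (firstHit θ (dictAfter d S₁) S₂) := by
  induction S₁ generalizing d with
  | nil =>
    by_cases h : entryCount d = θ
    · simp [firstHit_of_entryCount_eq _ h]
    · simp [firstHit, h, dictAfter]
  | cons o S ih =>
    simp only [List.cons_append, firstHit, dictAfter_cons]
    split_ifs
    · simp
    · exact ih _

theorem entryCount_of_firstHit {θ : ℕ} {d x : K → Option V} {S : List (DictOp K V)}
    (h : firstHit θ d S = some x) : entryCount x = θ := by
  induction S generalizing d with
  | nil =>
    simp only [firstHit] at h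
    split_ifs at h with h'
    cases h
    exact h'
  | cons o S ih =>
    simp only [firstHit] at h
    split_ifs at h with h'
    · cases h
      exact h'
    · exact ih h

/-- All numbers of entries up to the peak are reached. -/
theorem isSome_firstHit {θ : ℕ} {d : K → Option V} {S : List (DictOp K V)}
    (hd : entryCount d ≤ θ) (h : θ ≤ peak d S) : (firstHit θ d S).isSome = true := by
  induction S generalizing d with
  | nil =>
    simp only [peak] at h
    simp [firstHit, le_antisymm hd h]
  | cons o S ih =>
    simp only [firstHit]
    split_ifs with h'
    · rfl
    · have h1 := entryCount_dictStep d o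
      refine ih (by omega) ?_
      simp only [peak] at h
      omega

theorem firstHit_eq_none {θ : ℕ} {d : K → Option V} {S : List (DictOp K V)}
    (h : peak d S < θ) : firstHit θ d S = none := by
  induction S generalizing d with
  | nil =>
    simp only [peak] at h
    simp only [firstHit]
    rw [if_neg (by omega)]
  | cons o S ih =>
    simp only [peak, max_lt_iff] at h
    simp only [firstHit]
    rw [if_neg (by omega)]
    exact ih h.2

theorem peak_lt_of_firstHit {θ : ℕ} {d : K → Option V} {S : List (DictOp K V)}
    (hd : entryCount d ≤ θ) (h : firstHit θ d S = none) : peak d S < θ := by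
  by_contra! h'
  simpa [h] using isSome_firstHit hd h'

/-! ### An additional entry -/

theorem firstHit_apply_of_target_ne {k : K} {θ : ℕ} {d x : K → Option V}
    {S : List (DictOp K V)} (hS : ∀ o ∈ S, o.target ≠ k) (h : firstHit θ d S = some x) :
    x k = d k := by
  induction S generalizing d with
  | nil =>
    simp only [firstHit] at h
    split_ifs at h
    cases h
    rfl
  | cons o S ih =>
    simp only [firstHit] at h
    split_ifs at h
    · cases h
      rfl
    · rw [ih (fun o' h => hS o' (by simp [h])) h, dictStep_apply_of_target_ne (hS o (by simp))]

/-- With an additional entry, every content is reached at a threshold higher by one. -/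
theorem firstHit_update {k : K} {S : List (DictOp K V)} (hS : ∀ o ∈ S, o.target ≠ k) (θ : ℕ)
    (d : K → Option V) (hd : d k = none) (v : V) :
    firstHit (θ + 1) (Function.update d k (some v)) S
      = (firstHit θ d S).map fun x => Function.update x k (some v) := by
  induction S generalizing d with
  | nil =>
    simp only [firstHit, entryCount_update_some hd, Nat.add_right_cancel_iff]
    split_ifs <;> rfl
  | cons o S ih =>
    simp only [firstHit, entryCount_update_some hd, Nat.add_right_cancel_iff]
    split_ifs
    · rfl
    · rw [dictStep_update (hS o (by simp)), ih fun o' h => hS o' (by simp [h])]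
      rw [dictStep_apply_of_target_ne (hS o (by simp)), hd]

theorem Padded.firstHit_eq {k : K} {S L : List (DictOp K V)} (h : Padded k S L)
    (hS : ∀ o ∈ S, o.target ≠ k) {d : K → Option V} (hd : d k = none) (θ : ℕ) :
    firstHit θ d L = firstHit θ d S := by
  induction h generalizing d with
  | nil => rfl
  | cons o _ ih =>
    simp only [firstHit]
    rw [ih (fun o' h => hS o' (by simp [h]))
      ((dictStep_apply_of_target_ne (hS o (by simp)) d).trans hd)]
  | pad _ ih =>
    simp only [firstHit, dictStep, hd, ih hS hd]
    split_ifs with h'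
    · rw [firstHit_of_entryCount_eq _ h']
    · rfl

/-- The first deletion of `k` in a padded sequence. -/
theorem Padded.split {K V : Type} {k : K} {S L : List (DictOp K V)} (h : Padded k S L)
    (hS : ∀ o ∈ S, o.target ≠ k) (hL : DictOp.delete k ∈ L) :
    ∃ S₁ S₂ L₂, S = S₁ ++ S₂ ∧ L = S₁ ++ DictOp.delete k :: L₂ ∧ Padded k S₂ L₂ := by
  induction h with
  | nil => simp at hL
  | @cons o S L _ ih =>
    have ho : o.target ≠ k := hS o (by simp)
    have hL' : DictOp.delete k ∈ L := by
      rcases List.mem_cons.mp hL with rfl | h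
      · exact absurd rfl ho
      · exact h
    obtain ⟨S₁, S₂, L₂, rfl, rfl, h⟩ := ih (fun o' h => hS o' (by simp [h])) hL'
    exact ⟨o :: S₁, S₂, L₂, rfl, rfl, h⟩
  | @pad S L h _ => exact ⟨[], S, L, rfl, rfl, h⟩

/-- `WithVisitor k S L`: the sequence `L` arises from `S` by adding nothing, or one insertion under
the key `k`, followed later by at least one deletion of `k`. -/
inductive WithVisitor {K V : Type} (k : K) (S : List (DictOp K V)) : List (DictOp K V) → Prop
  | absent : WithVisitor k S S
  | present (S₁ S₂ : List (DictOp K V)) (v : V) (L : List (DictOp K V)) (hS : S = S₁ ++ S₂)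
      (h : Padded k S₂ L) (hL : DictOp.delete k ∈ L) :
      WithVisitor k S (S₁ ++ DictOp.insert k v :: L)

theorem WithVisitor.append_left {K V : Type} {k : K} {S L : List (DictOp K V)}
    (h : WithVisitor k S L) (o : DictOp K V) : WithVisitor k (o :: S) (o :: L) := by
  cases h with
  | absent => exact WithVisitor.absent
  | present S₁ S₂ v L hS h hL =>
    exact WithVisitor.present (o :: S₁) S₂ v L (by rw [hS]; rfl) h hL

/-- The effect of a visitor whose key is not used otherwise: the final content is the same, and up to
a shift of the threshold the first hits agree or differ by the entry of the visitor, with the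
exception of one threshold. -/
theorem WithVisitor.compare {k : K} {S L : List (DictOp K V)} (h : WithVisitor k S L)
    (hS : ∀ o ∈ S, o.target ≠ k) :
    dictAfter (fun _ => none) L = dictAfter (fun _ => none) S ∧
    ∃ A B : ℕ, ∀ θ,
      ((θ ≤ A ∨ B + 1 < θ) → firstHit θ (fun _ => none) L = firstHit θ (fun _ => none) S) ∧
      (A < θ → θ ≤ B → ∃ x v, x k = none ∧ firstHit θ (fun _ => none) S = some x ∧
        firstHit (θ + 1) (fun _ => none) L = some (Function.update x k (some v))) := by
  cases h with
  -- With `A = B` the range of shifted thresholds is empty, and the first hits agree everywhere.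
  | absent => exact ⟨rfl, 0, 0, fun θ => ⟨fun _ => rfl, fun h1 h2 => by omega⟩⟩
  | present S₁ S' v L hS' h hL =>
    -- Three segments are distinguished: `S₁` before the visit, `S₂` between the insertion and the
    -- first deletion of `k`, and `S₃` afterwards, where further deletions of `k` have no effect.
    subst hS'
    obtain ⟨S₂, S₃, L₃, rfl, rfl, hp⟩ :=
      h.split (fun o ho => hS o (List.mem_append_right _ ho)) hL
    have hS1 : ∀ o ∈ S₁, o.target ≠ k := fun o ho => hS o (by simp [ho])
    have hS2 : ∀ o ∈ S₂, o.target ≠ k := fun o ho => hS o (by simp [ho])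
    have hS3 : ∀ o ∈ S₃, o.target ≠ k := fun o ho => hS o (by simp [ho])
    set d₀ : K → Option V := fun _ => none with hd0
    set d₁ := dictAfter d₀ S₁ with hd1
    set d₂ := dictAfter d₁ S₂ with hd2
    have hk1 : d₁ k = none := dictAfter_apply_of_target_ne hS1 _
    have hk2 : d₂ k = none := (dictAfter_apply_of_target_ne hS2 _).trans hk1
    have hins : (dictStep d₁ (DictOp.insert k v)).1 = Function.update d₁ k (some v) := by
      simp [dictStep, hk1]
    have hdel : (dictStep (Function.update d₂ k (some v)) (DictOp.delete k)).1 = d₂ := by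
      simp [dictStep, ← hk2]
    have hafter : dictAfter (Function.update d₁ k (some v)) S₂ = Function.update d₂ k (some v) :=
      dictAfter_update hS2 d₁ _
    have hmid : ∀ θ, firstHit (θ + 1) d₀ S₁ = none →
        firstHit (θ + 1) d₀ (S₁ ++ DictOp.insert k v :: (S₂ ++ DictOp.delete k :: L₃))
          = ((firstHit θ d₁ S₂).map fun x => Function.update x k (some v)).or
              (firstHit (θ + 1) d₂ S₃) := by
      intro θ h1
      have hc1 : entryCount d₁ < θ + 1 := (entryCount_after_le_peak _ _).trans_lt
        (peak_lt_of_firstHit (by simp [hd0, entryCount_empty]) h1)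
      rw [firstHit_append, h1, Option.none_or, firstHit, if_neg hc1.ne, hins, firstHit_append,
        firstHit_update hS2 _ _ hk1]
      cases h2 : firstHit θ d₁ S₂ with
      | some x => rfl
      | none =>
        -- If `S₂` does not hit `θ`, then its last content has fewer than `θ` entries; even with the
        -- visitor's entry the size is below `θ + 1`, so the step at the deletion is no hit either.
        have hc2 := entryCount_after_le_peak d₁ S₂
        have hc3 := peak_lt_of_firstHit (Nat.lt_succ_iff.mp hc1) h2
        rw [← hd2] at hc2
        rw [hafter, firstHit, entryCount_update_some hk2, if_neg (by omega), hdel,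
          hp.firstHit_eq hS3 hk2]
    have hideal : ∀ θ, firstHit θ d₀ (S₁ ++ (S₂ ++ S₃))
        = (firstHit θ d₀ S₁).or ((firstHit θ d₁ S₂).or (firstHit θ d₂ S₃)) := by
      intro θ
      rw [firstHit_append, firstHit_append]
    have h0 : entryCount d₀ = 0 := by simp [hd0, entryCount_empty]
    have hpeak1 : entryCount d₁ ≤ peak d₀ S₁ := entryCount_after_le_peak _ _
    -- The maximum ensures that a threshold above `B` is not hit during `S₁` either. Nothing is
    -- claimed for the real threshold `A + 1`, where the visitor's insertion itself may be the hit.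
    refine ⟨?_, peak d₀ S₁, max (peak d₀ S₁) (peak d₁ S₂), fun θ => ⟨?_, ?_⟩⟩
    · rw [dictAfter_append, dictAfter_cons, hins, dictAfter_append, hafter, dictAfter_cons, hdel,
        hp.after_eq hS3 hk2, dictAfter_append, dictAfter_append]
    · rintro (hθ | hθ)
      · obtain ⟨x, hx⟩ := Option.isSome_iff_exists.mp (isSome_firstHit (by omega) hθ)
        rw [firstHit_append, firstHit_append, hx]
        rfl
      · obtain ⟨θ, rfl⟩ : ∃ t, θ = t + 1 := ⟨θ - 1, by omega⟩
        rw [max_def] at hθ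
        have h1 : firstHit (θ + 1) d₀ S₁ = none := firstHit_eq_none (by split_ifs at hθ <;> omega)
        rw [hmid θ h1, hideal, h1, firstHit_eq_none (S := S₂) (by split_ifs at hθ <;> omega),
          firstHit_eq_none (S := S₂) (by split_ifs at hθ <;> omega)]
        rfl
    · intro hA hB
      have hB' : θ ≤ peak d₁ S₂ := by
        rcases le_max_iff.mp hB with h | h <;> omega
      obtain ⟨x, hx⟩ := Option.isSome_iff_exists.mp
        (isSome_firstHit (d := d₁) (S := S₂) (by omega) hB')
      refine ⟨x, v, (firstHit_apply_of_target_ne hS2 hx).trans hk1, ?_, ?_⟩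
      · rw [hideal, firstHit_eq_none hA, hx]
        rfl
      · rw [hmid θ (firstHit_eq_none (by omega)), hx]
        rfl

end Contents

/-! ### The law of the state of the collector after a sequence of operations -/

/-- A sequence of operations is executed one after the other. -/
def runOps {α σ : Type} (step : α → σ → PMF σ) : List α → σ → PMF σ
  | [], s => PMF.pure s
  | o :: S, s => (step o s).bind (runOps step S)

theorem runOps_append {α σ : Type} (step : α → σ → PMF σ) (S₁ S₂ : List α) (s : σ) :
    runOps step (S₁ ++ S₂) s = (runOps step S₁ s).bind (runOps step S₂) := by
  induction S₁ generalizing s with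
  | nil => simp only [List.nil_append, runOps, PMF.pure_bind]
  | cons o S ih =>
    simp only [List.cons_append, runOps, PMF.bind_bind]
    congr 1
    funext s'
    exact ih s'

section CollectorLaw

variable {V Out : Type} {n : ℕ}

open Classical in
/-- The summary of a random tuple of `n` distinct entries of a content. -/
def summarizeContent (summarize : (k : ℕ) → (Fin k → V) → PMF Out) (d : Key n → Option V) :
    PMF (Option Out) :=
  if h : Nonempty (Fin n ↪ {k : Key n // (d k).isSome = true}) then do
    let S ← @PMF.uniformOfFintype (Fin n ↪ {k : Key n // (d k).isSome = true}) inferInstance h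
    let out ← summarize n fun i => (d (S i).1).get (S i).2
    pure (some out)
  else pure none

/-- The law of the summary, given the content on which it is computed, if any. -/
def summaryLaw (summarize : (k : ℕ) → (Fin k → V) → PMF Out) :
    Option (Key n → Option V) → PMF (Option Out)
  | none => PMF.pure none
  | some d => summarizeContent summarize d

/-- The collector executes an operation on its dictionary. -/
def collectorStep (summarize : (k : ℕ) → (Fin k → V) → PMF Out) (I : DictImpl (Key n) V)
    (o : DictOp (Key n) V) (s : DPState I Out) : PMF (DPState I Out) :=
  match o with
  | DictOp.insert k v => (I.step (DictOp.insert k v) s.mem).bind fun p =>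
      maybeSummarize summarize I
        (match p.2 with
        | DictResult.inserted true =>
            { s with
              mem := p.1
              count := s.count + 1
              thr := if s.summarized then s.thr + 1 else s.thr }
        | _ => { s with mem := p.1 })
  | DictOp.lookup k => (I.step (DictOp.lookup k) s.mem).bind fun p => PMF.pure { s with mem := p.1 }
  | DictOp.delete k => (I.step (DictOp.delete k) s.mem).bind fun p => PMF.pure
        (match p.2 with
        | DictResult.deleted true =>
            { s with
              mem := p.1
              count := s.count - 1
              thr := if s.summarized then s.thr - 1 else s.thr }
        | _ => { s with mem := p.1 })

variable (summarize : (k : ℕ) → (Fin k → V) → PMF Out) (I : DictImpl (Key n) V)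

theorem maybeSummarize_of_ne {s : DPState I Out} (h : s.count ≠ s.thr ∨ s.summarized = true) :
    maybeSummarize summarize I s = PMF.pure s := by
  rw [maybeSummarize, if_neg]
  · rfl
  · rintro ⟨h1, h2⟩
    rcases h with h | h
    · exact h h1
    · simp [h2] at h

theorem maybeSummarize_of_eq {s : DPState I Out} (h : s.count = s.thr)
    (h' : s.summarized = false) :
    maybeSummarize summarize I s = (summarizeContent summarize (I.entries s.mem)).bind fun out =>
      PMF.pure { s with summary := out, summarized := true } := by
  rw [maybeSummarize, if_pos ⟨h, h'⟩]
  rfl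

/-- The key and the answer do not depend on the state, so the key can be separated from the
dictionary operation and drawn in advance. -/
theorem dpInsert_eq (v : V) (s : DPState I Out) :
    dpInsert summarize I v s = (PMF.uniformOfFintype (Key n)).bind fun k =>
      (collectorStep summarize I (DictOp.insert k v) s).map fun s' =>
        (s', some (DPMessage.key k)) := by
  simp only [dpInsert, collectorStep, PMF.map, PMF.bind_bind]
  rfl

theorem dpDelete_eq (k : Key n) (s : DPState I Out) :
    dpDelete I k s = (collectorStep summarize I (DictOp.delete k) s).map fun s' =>
        (s', (none : Option (DPMessage V n))) := by
  simp only [dpDelete, collectorStep, PMF.map, PMF.bind_bind, PMF.pure_bind]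
  rfl

/-- The law of the memory of the dictionary after a sequence of operations. -/
def memoryLaw (S : List (DictOp (Key n) V)) : PMF I.Mem := (I.run S).map Prod.fst

theorem runFrom_append_singleton (S : List (DictOp (Key n) V)) (o : DictOp (Key n) V)
    (m : I.Mem) :
    I.runFrom (S ++ [o]) m = (I.runFrom S m).bind fun p =>
      (I.step o p.1).map fun q => (q.1, p.2 ++ [q.2]) := by
  induction S generalizing m with
  | nil =>
    change (I.step o m).bind (fun p => (PMF.pure (p.1, [])).bind fun q => PMF.pure (q.1, p.2 :: q.2))
      = (PMF.pure (m, [])).bind _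
    simp only [PMF.pure_bind, PMF.map]
    rfl
  | cons a S ih =>
    change (I.step a m).bind (fun p => (I.runFrom (S ++ [o]) p.1).bind fun q =>
        PMF.pure (q.1, p.2 :: q.2))
      = ((I.step a m).bind fun p => (I.runFrom S p.1).bind fun q =>
        PMF.pure (q.1, p.2 :: q.2)).bind _
    simp only [ih, PMF.map, PMF.bind_bind, PMF.pure_bind, Function.comp_def, List.cons_append]

theorem run_append_singleton (S : List (DictOp (Key n) V)) (o : DictOp (Key n) V) :
    I.run (S ++ [o]) = (I.run S).bind fun p =>
      (I.step o p.1).map fun q => (q.1, p.2 ++ [q.2]) := by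
  simp only [DictImpl.run, PMF.bind_bind]
  congr 1
  funext m
  exact runFrom_append_singleton I S o m

theorem memoryLaw_nil : memoryLaw I [] = I.start := by
  change (I.start.bind fun m => PMF.pure (m, [])).map Prod.fst = _
  simp only [PMF.map, PMF.bind_bind, PMF.pure_bind, Function.comp_apply, PMF.bind_pure]

theorem memoryLaw_append_singleton (S : List (DictOp (Key n) V)) (o : DictOp (Key n) V) :
    memoryLaw I (S ++ [o]) = (memoryLaw I S).bind fun m => (I.step o m).map Prod.fst := by
  simp only [memoryLaw, run_append_singleton, PMF.map, PMF.bind_bind, PMF.pure_bind,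
    Function.comp_def]

variable {I}

/-- `IsDictionary` speaks of complete runs from the initial memory. A memory in the support of
`memoryLaw` is the end of such a run, so the run can be extended by one operation and its last
result read off. -/
theorem step_result (hI : I.IsDictionary) {S : List (DictOp (Key n) V)} {o : DictOp (Key n) V}
    {m : I.Mem} (hm : m ∈ (memoryLaw I S).support) {q : I.Mem × DictResult V}
    (hq : q ∈ (I.step o m).support) :
    q.2 = (dictStep (dictAfter (fun _ => none) S) o).2 ∧
      I.entries q.1 = (dictStep (dictAfter (fun _ => none) S) o).1 := by
  rw [memoryLaw, PMF.mem_support_map_iff] at hm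
  obtain ⟨⟨m', rs⟩, hp, rfl⟩ := hm
  have hmem : (q.1, rs ++ [q.2]) ∈ (I.run (S ++ [o])).support := by
    rw [run_append_singleton, PMF.mem_support_bind_iff]
    exact ⟨_, hp, (PMF.mem_support_map_iff _ _ _).mpr ⟨q, hq, rfl⟩⟩
  obtain ⟨h1, h2⟩ := hI _ _ hmem
  have h3 := (hI _ _ hp).1
  have happ : ∀ (S : List (DictOp (Key n) V)) (d : Key n → Option V),
      dictResults d (S ++ [o]) = dictResults d S ++ [(dictStep (dictAfter d S) o).2] := by
    intro S
    induction S with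
    | nil => intro d; rfl
    | cons a S ih => intro d; simp [dictResults, ih, dictAfter]
  simp only at h1 h2 h3
  rw [happ, ← h3] at h1
  refine ⟨by simpa using h1, ?_⟩
  rw [h2, dictAfter_append]
  rfl

/-- The law of the state of the collector with memory law `μ`, `c` entries and initial threshold
`θ`, whose summary was computed on the content `h`, if at all. -/
def stateLaw (μ : PMF I.Mem) (c θ : ℕ) (h : Option (Key n → Option V)) : PMF (DPState I Out) :=
  μ.bind fun m => (summaryLaw summarize h).bind fun out =>
    -- Once a summary exists, threshold and count are equal and move together, so the initial
    -- threshold is forgotten. Therefore states that arose from different initial thresholds can be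
    -- compared.
    PMF.pure ⟨m, if h.isSome then c else θ, c, h.isSome, out⟩

/-- As long as there is no summary the count is below the threshold, and lookups and deletions do
not raise it. Appending the summary check to every operation thus changes nothing and brings all
three kinds into one form. -/
theorem collectorStep_eq (hI : I.IsDictionary) {S : List (DictOp (Key n) V)}
    (o : DictOp (Key n) V) {m : I.Mem} (hm : m ∈ (memoryLaw I S).support) (θ : ℕ) (b : Bool)
    (out : Option Out)
    (hb : b = false → entryCount (dictAfter (fun _ => none) S) < θ) :
    collectorStep summarize I o
        ⟨m, if b then entryCount (dictAfter (fun _ => none) S) else θ,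
          entryCount (dictAfter (fun _ => none) S), b, out⟩
      = (I.step o m).bind fun p => maybeSummarize summarize I
          ⟨p.1, if b then entryCount (dictStep (dictAfter (fun _ => none) S) o).1 else θ,
            entryCount (dictStep (dictAfter (fun _ => none) S) o).1, b, out⟩ := by
  set d : Key n → Option V := dictAfter (fun _ => none) S with hd
  cases o with
  | insert k v =>
    refine bind_congr_support fun p hp => ?_
    have h1 := (step_result hI hm hp).1
    rw [← hd] at h1
    cases hk : d k with
    | none =>
      simp only [dictStep, hk] at h1 ⊢
      rw [h1, entryCount_update_some hk]
      cases b <;> rfl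
    | some w =>
      simp only [dictStep, hk] at h1 ⊢
      rw [h1]
  | lookup k =>
    refine bind_congr_support fun p hp => ?_
    rw [maybeSummarize_of_ne]
    · rfl
    · cases b
      · exact Or.inl (hb rfl).ne
      · exact Or.inr rfl
  | delete k =>
    refine bind_congr_support fun p hp => ?_
    have h1 := (step_result hI hm hp).1
    rw [← hd] at h1
    cases hk : d k with
    | none =>
      simp only [dictStep, hk] at h1 ⊢
      rw [h1, maybeSummarize_of_ne]
      cases b
      · exact Or.inl (hb rfl).ne
      · exact Or.inr rfl
    | some w =>
      have hc := entryCount_update_none hk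
      simp only [dictStep, hk] at h1 ⊢
      rw [h1, maybeSummarize_of_ne]
      · simp only [← hc]
        cases b <;> rfl
      · cases b
        · have := hb rfl
          left
          simp
          omega
        · exact Or.inr rfl

theorem firstHit_append_singleton {K V : Type} [Fintype K] [DecidableEq K] (θ : ℕ)
    (d : K → Option V) (S : List (DictOp K V)) (o : DictOp K V) :
    firstHit θ d (S ++ [o]) = (firstHit θ d S).or
      (if entryCount (dictStep (dictAfter d S) o).1 = θ
        then some (dictStep (dictAfter d S) o).1 else none) := by
  induction S generalizing d with
  | nil =>
    by_cases h : entryCount d = θ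
    · simp [firstHit, h]
    · simp [firstHit, h, dictAfter]
      rfl
  | cons a S ih =>
    by_cases h : entryCount d = θ
    · simp [firstHit, h]
    · simp only [List.cons_append, firstHit, if_neg h]
      exact ih _

/-- The memory and the summary are independent given the operations. -/
theorem start_bind_runOps (hI : I.IsDictionary) {θ : ℕ} (hθ : 0 < θ)
    (S : List (DictOp (Key n) V)) :
    (I.start.bind fun m => runOps (collectorStep summarize I) S ⟨m, θ, 0, false, none⟩)
      = stateLaw summarize (memoryLaw I S) (entryCount (dictAfter (fun _ => none) S)) θ
          (firstHit θ (fun _ => none) S) := by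
  induction S using List.reverseRecOn with
  | nil =>
    have h : firstHit θ (fun _ : Key n => (none : Option V)) [] = none := by
      simp only [firstHit, entryCount_empty]
      rw [if_neg hθ.ne]
    rw [h, stateLaw, memoryLaw_nil]
    simp [summaryLaw, runOps, dictAfter, entryCount_empty]
  | append_singleton S o ih =>
    simp only [runOps_append]
    rw [← PMF.bind_bind, ih]
    have hsingle : runOps (collectorStep summarize I) [o] = collectorStep summarize I o := by
      funext s
      exact PMF.bind_pure _
    rw [hsingle, firstHit_append_singleton, dictAfter_append]
    change _ = stateLaw summarize _ (entryCount (dictStep (dictAfter (fun _ => none) S) o).1) θ _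
    rw [stateLaw, stateLaw, memoryLaw_append_singleton, PMF.bind_bind, PMF.bind_bind]
    refine bind_congr_support fun m hm => ?_
    simp only [PMF.bind_bind, PMF.pure_bind, PMF.map, Function.comp_apply]
    cases h : firstHit θ (fun _ => none) S with
    | some x =>
      have h1 := fun out => collectorStep_eq summarize hI o hm θ true out (by simp)
      simp only [Option.isSome_some, Option.some_or, if_true] at h1 ⊢
      simp only [h1]
      -- The summary was drawn earlier and is not used by the dictionary, so its draw can be
      -- exchanged with the new operation on the memory.
      rw [PMF.bind_comm]
      congr 1
      funext p
      congr 1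
      funext out
      exact maybeSummarize_of_ne _ _ (Or.inr rfl)
    | none =>
      have hlt := (entryCount_after_le_peak (fun _ => none) S).trans_lt
        (peak_lt_of_firstHit (by simp [entryCount_empty]) h)
      have h1 := collectorStep_eq summarize hI o hm θ false none (fun _ => hlt)
      simp only [Option.isSome_none, Option.none_or, summaryLaw, PMF.pure_bind,
        Bool.false_eq_true, if_false] at h1 ⊢
      rw [h1]
      refine bind_congr_support fun p hp => ?_
      -- The content read off the memory is the same for every memory in the support, so the new
      -- summary does not depend on which memory was reached.
      have h2 := (step_result hI hm hp).2
      by_cases h3 : entryCount (dictStep (dictAfter (fun _ => none) S) o).1 = θ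
      · rw [maybeSummarize_of_eq _ _ h3 rfl, if_pos h3]
        simp only [h2, h3]
        rfl
      · rw [maybeSummarize_of_ne _ _ (Or.inl h3), if_neg h3]
        simp

end CollectorLaw

/-! ### Sampling from neighbouring contents -/

section Sampling

variable {K V : Type} [Fintype K] [DecidableEq K]

open Classical in
/-- The injective `n`-tuples of keys of stored entries. -/
def injTuples (n : ℕ) (d : K → Option V) : Finset (Fin n → K) :=
  Finset.univ.filter fun S => Function.Injective S ∧ ∀ i, (d (S i)).isSome = true

theorem mem_injTuples {n : ℕ} {d : K → Option V} {S : Fin n → K} :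
    S ∈ injTuples n d ↔ Function.Injective S ∧ ∀ i, (d (S i)).isSome = true := by
  simp [injTuples]

/-- Injective tuples of keys of stored entries as embeddings. -/
def injTuplesEquiv (n : ℕ) (d : K → Option V) :
    (Fin n ↪ {k : K // (d k).isSome = true}) ≃ {S : Fin n → K // S ∈ injTuples n d} where
  toFun e := ⟨fun i => (e i).1, mem_injTuples.mpr
    ⟨fun _ _ h => e.injective (Subtype.ext h), fun i => (e i).2⟩⟩
  invFun S := ⟨fun i => ⟨S.1 i, (mem_injTuples.mp S.2).2 i⟩, fun _ _ h =>
    (mem_injTuples.mp S.2).1 (congrArg Subtype.val h)⟩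
  left_inv e := by ext; rfl
  right_inv S := by ext; rfl

theorem card_injTuples (n : ℕ) (d : K → Option V) :
    (injTuples n d).card = (entryCount d).descFactorial n := by
  classical
  rw [← Fintype.card_coe, ← Fintype.card_congr (injTuplesEquiv n d), Fintype.card_embedding_eq,
    Fintype.card_fin, Fintype.card_subtype]
  rfl

/-- Replacing the key `k` at position `i` by the key of another entry. -/
theorem sum_injTuples_fiber {n : ℕ} {d : K → Option V} {k : K} (hk : d k = none) (v : V)
    (i : Fin n) (f : (Fin n → K) → ℝ≥0∞) :
    ∑ S ∈ injTuples n d, f (Function.update S i k)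
      = (entryCount d + 1 - n : ℕ) *
        ∑ S ∈ (injTuples n (Function.update d k (some v))).filter (fun S => S i = k), f S := by
  classical
  have hmaps : ∀ S ∈ injTuples n d, Function.update S i k ∈
      (injTuples n (Function.update d k (some v))).filter (fun S => S i = k) := by
    intro S hS
    rw [mem_injTuples] at hS
    have hne : ∀ j, S j ≠ k := fun j h => by
      have := hS.2 j
      rw [h, hk] at this
      simp at this
    rw [Finset.mem_filter, mem_injTuples]
    refine ⟨⟨fun a b hab => ?_, fun j => ?_⟩, by simp⟩
    · by_cases ha : a = i <;> by_cases hb : b = i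
      · rw [ha, hb]
      · subst ha
        simp only [Function.update_self, Function.update_of_ne hb] at hab
        exact absurd hab.symm (hne b)
      · subst hb
        simp only [Function.update_self, Function.update_of_ne ha] at hab
        exact absurd hab (hne a)
      · simp only [Function.update_of_ne ha, Function.update_of_ne hb] at hab
        exact hS.1 hab
    · by_cases hj : j = i
      · simp [hj]
      · simp [Function.update_of_ne hj, Function.update_of_ne (hne j), hS.2 j]
  -- Every tuple `S` with `k` at position `i` has the same number of preimages: position `i` can
  -- receive any of the `entryCount d - (n - 1)` stored keys not used at the other `n - 1`
  -- positions.
  rw [← Finset.sum_fiberwise_of_maps_to hmaps, Finset.mul_sum]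
  refine Finset.sum_congr rfl fun S hS => ?_
  have hconst : ∀ S' ∈ (injTuples n d).filter (fun S' => Function.update S' i k = S),
      f (Function.update S' i k) = f S := fun S' h => by rw [(Finset.mem_filter.mp h).2]
  rw [Finset.sum_congr rfl hconst, Finset.sum_const, nsmul_eq_mul]
  congr 2
  rw [Finset.mem_filter, mem_injTuples] at hS
  obtain ⟨⟨hinj, hsome⟩, hSi⟩ := hS
  have hne : ∀ j, j ≠ i → S j ≠ k := fun j hj h => hj (hinj (h.trans hSi.symm))
  have hsome' : ∀ j, j ≠ i → (d (S j)).isSome = true := fun j hj => by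
    have := hsome j
    rwa [Function.update_of_ne (hne j hj)] at this
  -- the fiber is in bijection with the stored keys that are not used
  have hcard : ((injTuples n d).filter fun S' => Function.update S' i k = S).card
      = ((Finset.univ.filter fun j => (d j).isSome = true) \
          ((Finset.univ.erase i).image S)).card := by
    refine Finset.card_bij' (fun S' _ => S' i) (fun x _ => Function.update S i x) ?_ ?_ ?_ ?_
    · intro S' hS'
      rw [Finset.mem_filter, mem_injTuples] at hS'
      obtain ⟨⟨h1, h2⟩, rfl⟩ := hS'
      simp only [Finset.mem_sdiff, Finset.mem_filter, Finset.mem_univ, true_and,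
        Finset.mem_image, Finset.mem_erase, not_exists, not_and, and_true]
      refine ⟨h2 i, fun j hj h => hj ?_⟩
      rw [Function.update_of_ne hj] at h
      exact h1 h
    · intro x hx
      simp only [Finset.mem_sdiff, Finset.mem_filter, Finset.mem_univ, true_and,
        Finset.mem_image, Finset.mem_erase, not_exists, not_and, and_true] at hx
      rw [Finset.mem_filter, mem_injTuples]
      refine ⟨⟨fun a b hab => ?_, fun j => ?_⟩, ?_⟩
      · by_cases ha : a = i <;> by_cases hb : b = i
        · rw [ha, hb]
        · subst ha
          simp only [Function.update_self, Function.update_of_ne hb] at hab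
          exact absurd hab.symm (hx.2 b hb)
        · subst hb
          simp only [Function.update_self, Function.update_of_ne ha] at hab
          exact absurd hab (hx.2 a ha)
        · simp only [Function.update_of_ne ha, Function.update_of_ne hb] at hab
          exact hinj hab
      · by_cases hj : j = i
        · simp [hj, hx.1]
        · simp [Function.update_of_ne hj, hsome' j hj]
      · simp [← hSi]
    · intro S' hS'
      obtain ⟨-, rfl⟩ := Finset.mem_filter.mp hS'
      simp
    · intro x _
      simp
  rw [hcard, Finset.card_sdiff_of_subset, Finset.card_image_of_injective _ hinj,
    Finset.card_erase_of_mem (Finset.mem_univ i), Finset.card_univ, Fintype.card_fin]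
  · have : 0 < n := i.pos
    have h2 : entryCount d = (Finset.univ.filter fun j => (d j).isSome = true).card := rfl
    omega
  · intro j hj
    simp only [Finset.mem_image, Finset.mem_erase, Finset.mem_univ, and_true] at hj
    obtain ⟨a, ha, rfl⟩ := hj
    simp [hsome' a ha]

/-- The average over the injective tuples from a content with an additional entry is at most `c` times
the average over those from the content, if this holds for tuples differing in one position. -/
theorem sum_injTuples_le {n : ℕ} {d : K → Option V} {k : K} (hk : d k = none) (v : V)
    (hn : n ≤ entryCount d) (f g : (Fin n → K) → ℝ≥0∞) (c : ℝ≥0∞)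
    (h0 : ∀ S ∈ injTuples n d, f S ≤ c * g S)
    (h1 : ∀ S ∈ injTuples n d, ∀ i, f (Function.update S i k) ≤ c * g S) :
    ((injTuples n (Function.update d k (some v))).card : ℝ≥0∞)⁻¹ *
        ∑ S ∈ injTuples n (Function.update d k (some v)), f S
      ≤ c * (((injTuples n d).card : ℝ≥0∞)⁻¹ * ∑ S ∈ injTuples n d, g S) := by
  classical
  set d' := Function.update d k (some v) with hd'
  set m := entryCount d with hm
  set F := ∑ S ∈ injTuples n d', f S with hF
  set G := ∑ S ∈ injTuples n d, g S with hG
  -- Tuples with the additional entry either avoid `k`, and are then tuples from `d`, or are counted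
  -- at a position that contains `k`.
  have hsplit : F ≤ ∑ S ∈ injTuples n d, f S +
      ∑ i : Fin n, ∑ S ∈ (injTuples n d').filter (fun S => S i = k), f S := by
    rw [hF, ← Finset.sum_filter_add_sum_filter_not (injTuples n d') (fun S => ∀ i, S i ≠ k)]
    refine add_le_add (Finset.sum_le_sum_of_subset fun S hS => ?_) ?_
    · rw [Finset.mem_filter, mem_injTuples] at hS
      refine mem_injTuples.mpr ⟨hS.1.1, fun i => ?_⟩
      have := hS.1.2 i
      rwa [hd', Function.update_of_ne (hS.2 i)] at this
    · calc ∑ S ∈ (injTuples n d').filter (fun S => ¬ ∀ i, S i ≠ k), f S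
          ≤ ∑ S ∈ (injTuples n d').filter (fun S => ¬ ∀ i, S i ≠ k),
              ∑ i : Fin n, (if S i = k then f S else 0) := by
            refine Finset.sum_le_sum fun S hS => ?_
            have h := (Finset.mem_filter.mp hS).2
            push Not at h
            obtain ⟨i, hi⟩ := h
            refine le_trans (by rw [if_pos hi]) (Finset.single_le_sum
              (f := fun i => if S i = k then f S else 0) (fun _ _ => zero_le) (Finset.mem_univ i))
        _ ≤ ∑ S ∈ injTuples n d', ∑ i : Fin n, (if S i = k then f S else 0) :=
            Finset.sum_le_sum_of_subset (Finset.filter_subset _ _)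
        _ = ∑ i : Fin n, ∑ S ∈ (injTuples n d').filter (fun S => S i = k), f S := by
            rw [Finset.sum_comm]
            simp only [Finset.sum_filter]
  -- The `m + 1 - n` replacements for `k` balance the weights: tuples avoiding `k` contribute `m + 1
  -- - n` times `c * G`, and each of the `n` positions contributes `c * G` once, which makes `m + 1`
  -- in total.
  have hF' : ((m + 1 - n : ℕ) : ℝ≥0∞) * F ≤ ((m + 1 : ℕ) : ℝ≥0∞) * (c * G) := by
    have hA : ∑ S ∈ injTuples n d, f S ≤ c * G := by
      rw [hG, Finset.mul_sum]
      exact Finset.sum_le_sum h0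
    have hB : ∀ i : Fin n, ((m + 1 - n : ℕ) : ℝ≥0∞) *
        ∑ S ∈ (injTuples n d').filter (fun S => S i = k), f S ≤ c * G := by
      intro i
      rw [← sum_injTuples_fiber hk v i f, hG, Finset.mul_sum]
      exact Finset.sum_le_sum fun S hS => h1 S hS i
    calc ((m + 1 - n : ℕ) : ℝ≥0∞) * F
        ≤ ((m + 1 - n : ℕ) : ℝ≥0∞) * (∑ S ∈ injTuples n d, f S) + ∑ i : Fin n,
          ((m + 1 - n : ℕ) : ℝ≥0∞) *
            ∑ S ∈ (injTuples n d').filter (fun S => S i = k), f S := by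
          rw [← Finset.mul_sum, ← mul_add]
          gcongr
      _ ≤ ((m + 1 - n : ℕ) : ℝ≥0∞) * (c * G) + ∑ i : Fin n, c * G := by
          exact add_le_add (by gcongr) (Finset.sum_le_sum fun i _ => hB i)
      _ = ((m + 1 : ℕ) : ℝ≥0∞) * (c * G) := by
          rw [Finset.sum_const, Finset.card_univ, Fintype.card_fin, nsmul_eq_mul, ← add_mul,
            ← Nat.cast_add, show m + 1 - n + n = m + 1 by omega]
  -- The ratio of the numbers of tuples is exactly the factor in `hF'`, so after normalization no
  -- loss beyond `c` remains.
  have hcards : (m + 1 - n) * (injTuples n d').card = (m + 1) * (injTuples n d).card := by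
    rw [card_injTuples, card_injTuples, hd', entryCount_update_some hk, ← hm,
      Nat.succ_descFactorial]
  have hcard0 : (injTuples n d).card ≠ 0 := by
    rw [card_injTuples]
    exact (Nat.descFactorial_pos.mpr hn).ne'
  have hcard0' : (injTuples n d').card ≠ 0 := by
    intro h
    rw [h] at hcards
    simp [hcard0] at hcards
  set a : ℝ≥0∞ := ((m + 1 - n : ℕ) : ℝ≥0∞) with ha
  set b : ℝ≥0∞ := ((m + 1 : ℕ) : ℝ≥0∞) with hb
  set N : ℝ≥0∞ := ((injTuples n d).card : ℝ≥0∞) with hN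
  set N' : ℝ≥0∞ := ((injTuples n d').card : ℝ≥0∞) with hN'
  have hc : a * N' = b * N := by
    rw [ha, hb, hN, hN', ← Nat.cast_mul, ← Nat.cast_mul, hcards]
  have ha0 : a ≠ 0 := by
    rw [ha, Nat.cast_ne_zero]
    omega
  have hN0 : N ≠ 0 := Nat.cast_ne_zero.mpr hcard0
  have hN0' : N' ≠ 0 := Nat.cast_ne_zero.mpr hcard0'
  have hNt : N ≠ ∞ := ENNReal.natCast_ne_top _
  have hNt' : N' ≠ ∞ := ENNReal.natCast_ne_top _
  have hat : a ≠ ∞ := ENNReal.natCast_ne_top _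
  have hmul : F * N ≤ N' * (c * G) := by
    rw [← ENNReal.mul_le_mul_iff_right ha0 hat]
    calc a * (F * N) = (a * F) * N := by ring
      _ ≤ (b * (c * G)) * N := by gcongr
      _ = (b * N) * (c * G) := by ring
      _ = a * (N' * (c * G)) := by rw [← hc]; ring
  rw [ENNReal.inv_mul_le_iff hN0' hNt']
  calc F = (F * N) * N⁻¹ := by rw [mul_assoc, ENNReal.mul_inv_cancel hN0 hNt, mul_one]
    _ ≤ (N' * (c * G)) * N⁻¹ := by gcongr
    _ = N' * (c * (N⁻¹ * G)) := by ring

end Sampling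

/-! ### Differential privacy of the summary of a random sample -/

section Privacy

variable {V Out : Type}

/-- As outputs are discrete, privacy for singletons can be weighted with `g` and summed. -/
theorem expect_le_of_isDifferentiallyPrivate {A : (n : ℕ) → (Fin n → V) → PMF Out} {ε : ℕ → ℝ}
    (hA : IsDifferentiallyPrivate A ε) {n : ℕ} {x x' : Fin n → V}
    (hx : {i | x i ≠ x' i}.Subsingleton) (g : Out → ℝ≥0∞) :
    expect (A n x) g ≤ ENNReal.ofReal (Real.exp (ε n)) * expect (A n x') g := by
  rw [← expect_mul_left]
  refine ENNReal.tsum_le_tsum fun o => ?_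
  have h := hA n x x' hx {o}
  rw [PMF.toOuterMeasure_apply_singleton, PMF.toOuterMeasure_apply_singleton] at h
  calc A n x o * g o ≤ (ENNReal.ofReal (Real.exp (ε n)) * A n x' o) * g o := by gcongr
    _ = A n x' o * (ENNReal.ofReal (Real.exp (ε n)) * g o) := by ring

open Classical in
-- Embeddings into the stored keys have a type that depends on `d`. Written as functions into all
-- keys, samples from different contents can be compared; the value `0` is never taken on `injTuples
-- n d`.
theorem expect_summarizeContent (summarize : (k : ℕ) → (Fin k → V) → PMF Out) {n : ℕ}
    {d : Key n → Option V} (hd : n ≤ entryCount d) (g : Option Out → ℝ≥0∞) :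
    expect (summarizeContent summarize d) g = ((injTuples n d).card : ℝ≥0∞)⁻¹ *
      ∑ S ∈ injTuples n d, (if h : ∀ i, (d (S i)).isSome = true then
        expect (summarize n fun i => (d (S i)).get (h i)) fun o => g (some o) else 0) := by
  have hcard : Fintype.card (Fin n ↪ {k : Key n // (d k).isSome = true})
      = (injTuples n d).card := by
    rw [Fintype.card_congr (injTuplesEquiv n d), Fintype.card_coe]
  have hne : Nonempty (Fin n ↪ {k : Key n // (d k).isSome = true}) := by
    rw [← Fintype.card_pos_iff, hcard, card_injTuples]
    exact Nat.descFactorial_pos.mpr hd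
  rw [summarizeContent, dif_pos hne]
  change expect ((PMF.uniformOfFintype _).bind fun S => (summarize n _).bind fun out =>
    PMF.pure (some out)) g = _
  simp only [expect_bind, expect_pure]
  have hsum : ∑ S : Fin n ↪ {k : Key n // (d k).isSome = true},
      expect (summarize n fun i => (d (S i).1).get (S i).2) (fun o => g (some o))
      = ∑ S ∈ injTuples n d, (if h : ∀ i, (d (S i)).isSome = true then
        expect (summarize n fun i => (d (S i)).get (h i)) fun o => g (some o) else 0) := by
    rw [← Finset.sum_coe_sort (injTuples n d)]
    rw [← (injTuplesEquiv n d).sum_comp]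
    refine Finset.sum_congr rfl fun S _ => ?_
    have h : ∀ i, (d ((injTuplesEquiv n d S).1 i)).isSome = true := fun i => (S i).2
    rw [dif_pos h]
    rfl
  rw [expect_uniformOfFintype, hcard, ← hsum]

/-- A tuple avoiding `k` yields the same values from both contents, and putting `k` at one position
changes one value only. In both cases privacy applies, and `sum_injTuples_le` averages over the
tuples. -/
theorem expect_summarizeContent_update {summarize : (k : ℕ) → (Fin k → V) → PMF Out} {ε : ℕ → ℝ}
    (hA : IsDifferentiallyPrivate summarize ε) {n : ℕ} {d : Key n → Option V}
    (hd : n ≤ entryCount d) {k : Key n} (hk : d k = none) (v : V) (g : Option Out → ℝ≥0∞) :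
    expect (summarizeContent summarize (Function.update d k (some v))) g
      ≤ ENNReal.ofReal (Real.exp (ε n)) * expect (summarizeContent summarize d) g := by
  rw [expect_summarizeContent summarize hd, expect_summarizeContent summarize
    (by rw [entryCount_update_some hk]; omega)]
  have hne : ∀ S ∈ injTuples n d, ∀ j, S j ≠ k := fun S hS j h => by
    have := (mem_injTuples.mp hS).2 j
    rw [h, hk] at this
    simp at this
  refine sum_injTuples_le hk v hd _ _ _ (fun S hS => ?_) fun S hS i => ?_
  · have h2 := (mem_injTuples.mp hS).2
    have h1 : ∀ i, (Function.update d k (some v) (S i)).isSome = true := fun i => by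
      rw [Function.update_of_ne (hne S hS i), h2 i]
    rw [dif_pos h1, dif_pos h2]
    refine expect_le_of_isDifferentiallyPrivate hA (fun a ha => absurd ?_ ha) _
    simp [Function.update_of_ne (hne S hS a)]
  · have h2 := (mem_injTuples.mp hS).2
    have h1 : ∀ j, (Function.update d k (some v) (Function.update S i k j)).isSome = true := by
      intro j
      by_cases hj : j = i
      · simp [hj]
      · rw [Function.update_of_ne hj, Function.update_of_ne (hne S hS j), h2 j]
    rw [dif_pos h1, dif_pos h2]
    have hsub : ∀ a, (Function.update d k (some v) (Function.update S i k a)).get (h1 a)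
        ≠ (d (S a)).get (h2 a) → a = i := by
      intro a ha
      by_contra h
      apply ha
      simp [Function.update_of_ne h, Function.update_of_ne (hne S hS a)]
    exact expect_le_of_isDifferentiallyPrivate hA
      (fun a ha b hb => (hsub a ha).trans (hsub b hb).symm) _

/-- A multiplicative comparison with factor `exp ε` of quantities bounded by one gives an additive
one with error `ε`. -/
theorem le_add_of_le_exp_mul {a b : ℝ≥0∞} {ε : ℝ} (hε : 0 ≤ ε) (ha : a ≤ 1) (hb : b ≤ 1)
    (h : a ≤ ENNReal.ofReal (Real.exp ε) * b) : a ≤ b + ENNReal.ofReal ε := by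
  have ha' : a ≠ ∞ := (ha.trans_lt ENNReal.one_lt_top).ne
  have hb' : b ≠ ∞ := (hb.trans_lt ENNReal.one_lt_top).ne
  lift a to NNReal using ha'
  lift b to NNReal using hb'
  have h1 : (a : ℝ) ≤ Real.exp ε * b := by
    have := ENNReal.toReal_mono (by finiteness) h
    rwa [ENNReal.toReal_mul, ENNReal.toReal_ofReal (Real.exp_pos _).le] at this
  have h2 : (a : ℝ) ≤ 1 := by exact_mod_cast ha
  -- Then `b ≥ exp (-ε) * a ≥ (1 - ε) * a ≥ a - ε`, the last step because `a ≤ 1`.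
  have h3 : Real.exp (-ε) * a ≤ b := by
    calc Real.exp (-ε) * a ≤ Real.exp (-ε) * (Real.exp ε * b) := by gcongr
      _ = b := by rw [← mul_assoc, ← Real.exp_add]; simp
  have h4 := Real.add_one_le_exp (-ε)
  have h5 : (a : ℝ) ≤ b + ε := by
    nlinarith [mul_nonneg a.2 (sub_nonneg.mpr h4), mul_nonneg hε (sub_nonneg.mpr h2)]
  rw [← ENNReal.ofReal_coe_nnreal, ← ENNReal.ofReal_coe_nnreal,
    ← ENNReal.ofReal_add b.coe_nonneg hε]
  exact ENNReal.ofReal_le_ofReal h5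

end Privacy

/-! ### Averaging over the threshold -/

section Threshold

theorem sum_Icc_le_of_shift {n A B : ℕ} {F G : ℕ → ℝ≥0∞} {δ : ℝ≥0∞}
    (hF : ∀ θ, F θ ≤ 1) (heq : ∀ θ, (θ ≤ A ∨ B + 1 < θ) → F θ = G θ)
    (hshift : ∀ θ, n < θ → A < θ → θ ≤ B → F (θ + 1) ≤ G θ + δ) :
    ∑ θ ∈ Finset.Icc (n + 1) (2 * n), F θ
      ≤ ∑ θ ∈ Finset.Icc (n + 1) (2 * n), G θ + n * δ + 1 := by
  set R := Finset.Icc (n + 1) (2 * n) with hR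
  -- The threshold given up is `A + 1`, or `n + 1` if the shift begins below the range, since
  -- otherwise `n + 1` could be sent to `n`, outside the range. If `θ₀` exceeds `2 * n`, none is
  -- lost.
  set θ₀ := max (A + 1) (n + 1) with hθ₀
  set φ : ℕ → ℕ := fun θ => if A + 1 < θ ∧ θ ≤ B + 1 then θ - 1 else θ with hφ
  have hmem : ∀ θ ∈ R.erase θ₀, θ ≠ A + 1 ∧ n < θ ∧ θ ≤ 2 * n ∧ (A + 1 < θ → n + 1 < θ) := by
    intro θ hθ
    rw [Finset.mem_erase, hR, Finset.mem_Icc] at hθ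
    have h1 := hθ.1
    rw [hθ₀, max_def] at h1
    split_ifs at h1 <;> omega
  have hle : ∀ θ ∈ R.erase θ₀, F θ ≤ G (φ θ) + δ := by
    intro θ hθ
    obtain ⟨h1, h2, h3, h4⟩ := hmem θ hθ
    by_cases h : A + 1 < θ ∧ θ ≤ B + 1
    · obtain ⟨t, rfl⟩ : ∃ t, θ = t + 1 := ⟨θ - 1, by omega⟩
      have : φ (t + 1) = t := by simp only [hφ, if_pos h, Nat.add_sub_cancel]
      rw [this]
      exact hshift t (by omega) (by omega) (by omega)
    · have : φ θ = θ := by simp only [hφ, if_neg h]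
      rw [this, heq θ (by omega)]
      exact le_self_add
  -- The shift moves the interval from `A + 2` to `B + 1` down by one; the only possible collision
  -- is at `A + 1`, which is excluded.
  have hinj : Set.InjOn φ (R.erase θ₀ : Finset ℕ) := by
    intro a ha b hb hab
    have h1 := hmem a ha
    have h2 := hmem b hb
    simp only [hφ] at hab
    split_ifs at hab <;> omega
  have hsub : (R.erase θ₀).image φ ⊆ R := by
    intro t ht
    obtain ⟨θ, hθ, rfl⟩ := Finset.mem_image.mp ht
    have h1 := hmem θ hθ
    rw [hR, Finset.mem_Icc]
    simp only [hφ]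
    split_ifs <;> omega
  calc ∑ θ ∈ R, F θ ≤ ∑ θ ∈ R.erase θ₀, F θ + 1 := by
        by_cases h : θ₀ ∈ R
        · rw [← Finset.sum_erase_add _ _ h]
          gcongr
          exact hF _
        · rw [Finset.erase_eq_of_notMem h]
          exact le_self_add
    _ ≤ ∑ θ ∈ R.erase θ₀, (G (φ θ) + δ) + 1 := by
        gcongr with θ hθ
        exact hle θ hθ
    _ = ∑ t ∈ (R.erase θ₀).image φ, G t + (R.erase θ₀).card * δ + 1 := by
        rw [Finset.sum_add_distrib, Finset.sum_image hinj, Finset.sum_const, nsmul_eq_mul]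
    _ ≤ ∑ θ ∈ R, G θ + n * δ + 1 := by
        gcongr
        refine Finset.card_erase_le.trans ?_
        rw [hR, Nat.card_Icc]
        omega

variable {V Out : Type} {n : ℕ}

/-- The effect of a visitor whose key is not used otherwise on the law of the final state, averaged
over the threshold. -/
theorem WithVisitor.expect_le {summarize : (k : ℕ) → (Fin k → V) → PMF Out} {ε : ℕ → ℝ}
    (hA : IsDifferentiallyPrivate summarize ε) (hε : 0 ≤ ε n) (hn : 0 < n)
    {I : DictImpl (Key n) V} (hI : I.HistoryIndependent) {k : Key n}
    {S L : List (DictOp (Key n) V)} (h : WithVisitor k S L) (hS : ∀ o ∈ S, o.target ≠ k)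
    {f : DPState I Out → ℝ≥0∞} (hf : ∀ s, f s ≤ 1) (hne : (Finset.Icc (n + 1) (2 * n)).Nonempty) :
    expect (PMF.uniformOfFinset (Finset.Icc (n + 1) (2 * n)) hne) (fun θ =>
        expect (stateLaw summarize (memoryLaw I L) (entryCount (dictAfter (fun _ => none) L)) θ
          (firstHit θ (fun _ => none) L)) f)
      ≤ expect (PMF.uniformOfFinset (Finset.Icc (n + 1) (2 * n)) hne) (fun θ =>
        expect (stateLaw summarize (memoryLaw I S) (entryCount (dictAfter (fun _ => none) S)) θ
          (firstHit θ (fun _ => none) S)) f) + (ENNReal.ofReal (ε n) + (n : ℝ≥0∞)⁻¹) := by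
  obtain ⟨hafter, A, B, hcmp⟩ := h.compare hS
  have hmem : memoryLaw I L = memoryLaw I S := hI L S fun T => by rw [hafter]
  rw [hmem, hafter, expect_uniformOfFinset, expect_uniformOfFinset]
  have hcard : (Finset.Icc (n + 1) (2 * n)).card = n := by
    rw [Nat.card_Icc]
    omega
  rw [hcard]
  have hn0 : (n : ℝ≥0∞) ≠ 0 := Nat.cast_ne_zero.mpr hn.ne'
  have hnt : (n : ℝ≥0∞) ≠ ∞ := ENNReal.natCast_ne_top _
  have key := sum_Icc_le_of_shift (n := n) (δ := ENNReal.ofReal (ε n))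
    (F := fun θ => expect (stateLaw summarize (memoryLaw I S)
      (entryCount (dictAfter (fun _ => none) S)) θ (firstHit θ (fun _ => none) L)) f)
    (G := fun θ => expect (stateLaw summarize (memoryLaw I S)
      (entryCount (dictAfter (fun _ => none) S)) θ (firstHit θ (fun _ => none) S)) f)
    (fun θ => expect_le_one hf)
    (fun θ hθ => by simp only [(hcmp θ).1 hθ])
    (fun θ hnθ hAθ hθB => by
      obtain ⟨x, v, hx, h1, h2⟩ := (hcmp θ).2 hAθ hθB
      simp only [h1, h2, stateLaw, expect_bind, expect_pure, summaryLaw, Option.isSome_some,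
        if_true]
      rw [← expect_const (memoryLaw I S) (ENNReal.ofReal (ε n)), ← expect_add]
      refine expect_mono fun m => ?_
      refine le_add_of_le_exp_mul hε (expect_le_one fun _ => hf _) (expect_le_one fun _ => hf _) ?_
      -- The ideal first hit has `θ > n` entries, so a sample of `n` entries exists.
      exact expect_summarizeContent_update hA
        (by rw [entryCount_of_firstHit h1]; exact hnθ.le) hx v _)
  refine (mul_le_mul_right key _).trans_eq ?_
  rw [mul_add, mul_add, ← mul_assoc, ENNReal.inv_mul_cancel hn0 hnt, one_mul, mul_one,
    add_assoc]

end Threshold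

/-! ### Instances in an execution -/

section Instances

variable {M : Type} (C : DataCollector M)

theorem length_le_of_mem_support_runRequester (Y : Requester M) (y : Y.Coins) {T : ℕ}
    {c c' : Config C} (h : c' ∈ (C.runRequester Y y T c).support) :
    c.instances.length ≤ c'.instances.length := by
  induction T generalizing c with
  | zero =>
    rw [DataCollector.runRequester] at h
    rw [(PMF.mem_support_pure_iff _ _).mp h]
  | succ T ih =>
    rw [DataCollector.runRequester] at h
    cases hY : Y.next y c.reqLog with
    | halt =>
      simp only [hY] at h
      rw [(PMF.mem_support_pure_iff _ _).mp h]
    | initiate x =>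
      simp only [hY] at h
      obtain ⟨⟨s, tr⟩, -, h⟩ := (PMF.mem_support_bind_iff _ _ _).mp h
      cases tr with
      | none =>
        rw [(PMF.mem_support_pure_iff _ _).mp h]
        simp
      | some ma =>
        refine le_trans ?_ (ih h)
        simp
    | delete i =>
      simp only [hY] at h
      split at h
      · obtain ⟨⟨s, tr⟩, -, h⟩ := (PMF.mem_support_bind_iff _ _ _).mp h
        cases tr with
        | none =>
          rw [(PMF.mem_support_pure_iff _ _).mp h]
          simp
        | some ma =>
          refine le_trans ?_ (ih h)
          simp
      · rw [(PMF.mem_support_pure_iff _ _).mp h]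

/-- Instances are never removed and every execution has some continuation. A reachable initiation
therefore shows in a possible final configuration, where a bound on the number of instances applies.
-/
theorem exists_mem_support_of_initiate (Y : Requester M) (y : Y.Coins) (T : ℕ) (c : Config C)
    {x : M} (hY : Y.next y c.reqLog = ReqAction.initiate x) :
    ∃ c' ∈ (C.runRequester Y y (T + 1) c).support,
      c.instances.length + 1 ≤ c'.instances.length := by
  obtain ⟨c', hc'⟩ := (C.runRequester Y y (T + 1) c).support_nonempty
  refine ⟨c', hc', ?_⟩
  rw [DataCollector.runRequester] at hc'
  simp only [hY] at hc'
  obtain ⟨⟨s, tr⟩, -, h⟩ := (PMF.mem_support_bind_iff _ _ _).mp hc'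
  cases tr with
  | none =>
    rw [(PMF.mem_support_pure_iff _ _).mp h]
    simp
  | some ma =>
    refine le_trans ?_ (length_le_of_mem_support_runRequester C Y y h)
    simp

/-- A property of the list of instances that is preserved by the deletion-requester is preserved by
the alive phase. -/
theorem runAlive_invariant (Z : Environment M) (z : Z.Coins) (Y : Requester M) (y : Y.Coins)
    (T : ℕ) (P : List (Instance M) → Prop)
    (hP : ∀ c, P c.instances → ∀ c' ∈ (C.runRequester Y y T c).support, P c'.instances)
    {k : ℕ} {c c' : Config C} (hc : P c.instances)
    (h : c' ∈ (C.runAlive Z z Y y T k c).support) : P c'.instances := by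
  induction k generalizing c with
  | zero =>
    rw [DataCollector.runAlive] at h
    rwa [(PMF.mem_support_pure_iff _ _).mp h]
  | succ k ih =>
    rw [DataCollector.runAlive] at h
    cases hZ : Z.next z c.envLog with
    | endAlive =>
      simp only [hZ] at h
      rwa [(PMF.mem_support_pure_iff _ _).mp h]
    | openSession κ =>
      simp only [hZ] at h
      exact ih (by exact hc) h
    | send i m =>
      simp only [hZ] at h
      split at h
      · obtain ⟨⟨s, r⟩, -, h⟩ := (PMF.mem_support_bind_iff _ _ _).mp h
        exact ih (by exact hc) h
      · exact ih (by exact hc) h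
    | wakeCollector =>
      simp only [hZ] at h
      obtain ⟨s, -, h⟩ := (PMF.mem_support_bind_iff _ _ _).mp h
      exact ih (by exact hc) h
    | wakeRequester w =>
      simp only [hZ] at h
      obtain ⟨c₁, h₁, h⟩ := (PMF.mem_support_bind_iff _ _ _).mp h
      have h₂ : P c₁.instances := hP _ (by exact hc) _ h₁
      exact ih (by exact h₂) h

theorem runRequester_silent (y : (Requester.silent M).Coins) (T : ℕ) (c : Config C) :
    C.runRequester (Requester.silent M) y T c = PMF.pure c := by
  cases T <;> rfl

theorem isRepresentative_silent (k T : ℕ) : C.IsRepresentative k (Requester.silent M) T := by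
  intro Z r hr
  obtain ⟨z, -, hr⟩ := (PMF.mem_support_bind_iff _ _ _).mp hr
  obtain ⟨y, -, hr⟩ := (PMF.mem_support_bind_iff _ _ _).mp hr
  obtain ⟨s, -, hr⟩ := (PMF.mem_support_bind_iff _ _ _).mp hr
  obtain ⟨c, hc, hr⟩ := (PMF.mem_support_bind_iff _ _ _).mp hr
  obtain ⟨s', -, hr⟩ := (PMF.mem_support_bind_iff _ _ _).mp hr
  rw [(PMF.mem_support_pure_iff _ _).mp hr]
  have := runAlive_invariant C Z z (Requester.silent M) y T (fun l => l = [])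
    (fun c hc c' hc' => by
      rw [runRequester_silent] at hc'
      rwa [(PMF.mem_support_pure_iff _ _).mp hc']) rfl hc
  simp [this]

end Instances

/-! ### Executions with the collector as deterministic sequences of operations -/

section Script

variable {V Out : Type} {n : ℕ}

/-- An activation of the environment that matters for the collector: an operation on the dictionary or
an activation of the deletion-requester. -/
abbrev EnvStep (V : Type) (n : ℕ) : Type := DictOp (Key n) V ⊕ Option (List Bool)

/-- The activations of the environment and what it sees, if the collector chooses the given keys. -/
def envScript (Z : Environment (DPMessage V n)) (z : Z.Coins) : List (Key n) →
    List (EnvEvent (DPMessage V n)) → List (Kind × Bool) →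
    List (EnvStep V n) × List (EnvEvent (DPMessage V n))
  | [], log, _ => ([], log)
  -- Every activation consumes a key, whether or not it inserts something; unused keys are averaged
  -- out later.
  | key :: ks, log, ss =>
    match Z.next z log with
    | EnvAction.endAlive => ([], log)
    | EnvAction.openSession κ => envScript Z z ks (EnvEvent.silent :: log) (ss ++ [(κ, false)])
    | EnvAction.send i m =>
        match ss[i]? with
        | some (κ, false) =>
            match κ, m with
            | Kind.main, DPMessage.value v =>
                let r := envScript Z z ks (EnvEvent.received i (DPMessage.key key) :: log)
                  (ss.set i (Kind.main, true))
                (Sum.inl (DictOp.insert key v) :: r.1, r.2)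
            | Kind.deletion, DPMessage.key k =>
                let r := envScript Z z ks (EnvEvent.silent :: log) (ss.set i (Kind.deletion, true))
                (Sum.inl (DictOp.delete k) :: r.1, r.2)
            | κ, _ => envScript Z z ks (EnvEvent.silent :: log) (ss.set i (κ, true))
        | _ => envScript Z z ks (EnvEvent.silent :: log) ss
    | EnvAction.wakeCollector => envScript Z z ks (EnvEvent.silent :: log) ss
    | EnvAction.wakeRequester w =>
        let r := envScript Z z ks (EnvEvent.silent :: log) ss
        (Sum.inr w :: r.1, r.2)

/-- The operations of the environment. -/
def envOps (es : List (EnvStep V n)) : List (DictOp (Key n) V) := es.filterMap Sum.getLeft?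

/-- The operations caused by the deletion-requester while it is active, and what it then has seen and
its instances, if its first instance of the main protocol gets the key `k` and there is no other. -/
def requesterTurn (Y : Requester (DPMessage V n)) (y : Y.Coins) (k : Key n) : ℕ →
    List (ReqEvent (DPMessage V n)) → List (Instance (DPMessage V n)) →
    List (DictOp (Key n) V) × List (ReqEvent (DPMessage V n)) × List (Instance (DPMessage V n))
  | 0, r, l => ([], r, l)
  | T + 1, r, l =>
    match Y.next y r with
    | ReqAction.halt => ([], r, l)
    | ReqAction.initiate x =>
        match l, x with
        | [], DPMessage.value v =>
            let t := requesterTurn Y y k T (ReqEvent.output (DPMessage.key k) :: r)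
              [⟨some (DPMessage.key k), false⟩]
            (DictOp.insert k v :: t.1, t.2)
        | [], _ => ([], r, [⟨none, false⟩])
        -- A default value: a second initiation does not occur for a `1`-representative requester.
        | l, _ => ([], r, l)
    | ReqAction.delete i =>
        match l[i]? with
        | some ⟨some (DPMessage.key j), _⟩ =>
            -- A deletion is not answered, so it ends the turn of the requester.
            ([DictOp.delete j], r, l.set i ⟨some (DPMessage.key j), true⟩)
        | some ⟨some t, _⟩ => ([], r, l.set i ⟨some t, true⟩)
        | _ => ([], r, l)

/-- The operations caused by the environment and the deletion-requester, and the instances of the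
latter. -/
def weave (Y : Requester (DPMessage V n)) (y : Y.Coins) (k : Key n) (T : ℕ) :
    List (EnvStep V n) → List (ReqEvent (DPMessage V n)) → List (Instance (DPMessage V n)) →
    List (DictOp (Key n) V) × List (Instance (DPMessage V n))
  | [], _, l => ([], l)
  | Sum.inl o :: es, r, l =>
      let t := weave Y y k T es r l
      (o :: t.1, t.2)
  | Sum.inr w :: es, r, l =>
      let a := requesterTurn Y y k T (ReqEvent.woken w :: r) l
      let t := weave Y y k T es a.2.1 a.2.2
      (a.1 ++ t.1, t.2)

/-- The operations of the terminate phase. -/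
def terminateOps : List (Instance (DPMessage V n)) → List (DictOp (Key n) V)
  | [] => []
  | ⟨some (DPMessage.key k), false⟩ :: l => DictOp.delete k :: terminateOps l
  | _ :: l => terminateOps l

/-- A given number of independent uniformly random keys. -/
def keyTape (n : ℕ) : ℕ → PMF (List (Key n))
  | 0 => PMF.pure []
  | T + 1 => (PMF.uniformOfFintype (Key n)).bind fun key =>
      (keyTape n T).bind fun ks => PMF.pure (key :: ks)

theorem length_of_mem_support_keyTape {T : ℕ} {ks : List (Key n)}
    (h : ks ∈ (keyTape n T).support) : ks.length = T := by
  induction T generalizing ks with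
  | zero =>
    rw [(PMF.mem_support_pure_iff _ _).mp h]
    rfl
  | succ T ih =>
    obtain ⟨key, -, h⟩ := (PMF.mem_support_bind_iff _ _ _).mp h
    obtain ⟨ks', h', h⟩ := (PMF.mem_support_bind_iff _ _ _).mp h
    rw [(PMF.mem_support_pure_iff _ _).mp h, List.length_cons, ih h']

theorem length_envScript (Z : Environment (DPMessage V n)) (z : Z.Coins) (ks : List (Key n))
    (log : List (EnvEvent (DPMessage V n))) (ss : List (Kind × Bool)) :
    (envScript Z z ks log ss).1.length ≤ ks.length := by
  induction ks generalizing log ss with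
  | nil => simp [envScript]
  | cons key ks ih =>
    simp only [envScript, List.length_cons]
    split
    · simp
    · exact (ih _ _).trans (Nat.le_succ _)
    · split
      · split
        · exact Nat.succ_le_succ (ih _ _)
        · exact Nat.succ_le_succ (ih _ _)
        · exact (ih _ _).trans (Nat.le_succ _)
      · exact (ih _ _).trans (Nat.le_succ _)
    · exact (ih _ _).trans (Nat.le_succ _)
    · exact Nat.succ_le_succ (ih _ _)

/-! ### The operations of the deletion-requester -/

theorem requesterTurn_completed (Y : Requester (DPMessage V n)) (y : Y.Coins) (k : Key n) (T : ℕ)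
    (r : List (ReqEvent (DPMessage V n))) (b : Bool) :
    ∃ b', (requesterTurn Y y k T r [⟨some (DPMessage.key k), b⟩]).2.2
        = [⟨some (DPMessage.key k), b'⟩] ∧
      (((requesterTurn Y y k T r [⟨some (DPMessage.key k), b⟩]).1 = [] ∧ b' = b) ∨
        ((requesterTurn Y y k T r [⟨some (DPMessage.key k), b⟩]).1 = [DictOp.delete k])) := by
  cases T with
  | zero => exact ⟨b, rfl, Or.inl ⟨rfl, rfl⟩⟩
  | succ T =>
    simp only [requesterTurn]
    cases Y.next y r with
    | halt => exact ⟨b, rfl, Or.inl ⟨rfl, rfl⟩⟩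
    | initiate x => exact ⟨b, rfl, Or.inl ⟨rfl, rfl⟩⟩
    | delete i =>
      cases i with
      | zero => exact ⟨true, rfl, Or.inr rfl⟩
      | succ i => exact ⟨b, rfl, Or.inl ⟨rfl, rfl⟩⟩

/-- After its instance the requester can only delete its own key. If it never does so, the flag
remains `false` and the terminate phase does it, so a deletion of `k` always occurs. -/
theorem weave_completed (Y : Requester (DPMessage V n)) (y : Y.Coins) (k : Key n) (T : ℕ)
    (es : List (EnvStep V n)) (r : List (ReqEvent (DPMessage V n))) (b : Bool) :
    Padded k (envOps es) ((weave Y y k T es r [⟨some (DPMessage.key k), b⟩]).1 ++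
        terminateOps (weave Y y k T es r [⟨some (DPMessage.key k), b⟩]).2) ∧
      (b = false → DictOp.delete k ∈ (weave Y y k T es r [⟨some (DPMessage.key k), b⟩]).1 ++
        terminateOps (weave Y y k T es r [⟨some (DPMessage.key k), b⟩]).2) := by
  induction es generalizing r b with
  | nil =>
    cases b with
    | false => exact ⟨Padded.nil.pad, fun _ => by simp [weave, terminateOps]⟩
    | true => exact ⟨Padded.nil, fun h => by simp at h⟩
  | cons e es ih =>
    cases e with
    | inl o =>
      obtain ⟨h1, h2⟩ := ih r b
      exact ⟨h1.cons o, fun h => List.mem_cons_of_mem _ (h2 h)⟩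
    | inr w =>
      obtain ⟨b', h1, h2⟩ := requesterTurn_completed Y y k T (ReqEvent.woken w :: r) b
      obtain ⟨h3, h4⟩ := ih
        (requesterTurn Y y k T (ReqEvent.woken w :: r) [⟨some (DPMessage.key k), b⟩]).2.1 b'
      simp only [weave, h1]
      rcases h2 with ⟨h2, rfl⟩ | h2
      · rw [h2]
        exact ⟨h3, h4⟩
      · rw [h2]
        exact ⟨h3.pad, fun _ => List.mem_cons_self⟩

theorem requesterTurn_failed (Y : Requester (DPMessage V n)) (y : Y.Coins) (k : Key n) (T : ℕ)
    (r : List (ReqEvent (DPMessage V n))) :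
    (requesterTurn Y y k T r [⟨none, false⟩]).2.2 = [⟨none, false⟩] ∧
      (requesterTurn Y y k T r [⟨none, false⟩]).1 = [] := by
  cases T with
  | zero => exact ⟨rfl, rfl⟩
  | succ T =>
    simp only [requesterTurn]
    cases Y.next y r with
    | halt => exact ⟨rfl, rfl⟩
    | initiate x => exact ⟨rfl, rfl⟩
    | delete i =>
      cases i with
      | zero => exact ⟨rfl, rfl⟩
      | succ i => exact ⟨rfl, rfl⟩

theorem weave_failed (Y : Requester (DPMessage V n)) (y : Y.Coins) (k : Key n) (T : ℕ)
    (es : List (EnvStep V n)) (r : List (ReqEvent (DPMessage V n))) :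
    weave Y y k T es r [⟨none, false⟩] = (envOps es, [⟨none, false⟩]) := by
  induction es generalizing r with
  | nil => rfl
  | cons e es ih =>
    cases e with
    | inl o =>
      simp only [weave, ih]
      rfl
    | inr w =>
      obtain ⟨h1, h2⟩ := requesterTurn_failed Y y k T (ReqEvent.woken w :: r)
      simp only [weave, h1, h2, ih]
      rfl

/-- On an activation without instances the deletion-requester does nothing or starts an instance. -/
theorem requesterTurn_nil (Y : Requester (DPMessage V n)) (y : Y.Coins) (T : ℕ)
    (r : List (ReqEvent (DPMessage V n))) :
    (∀ k, requesterTurn Y y k T r [] = ([], r, [])) ∨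
    (∀ k, requesterTurn Y y k T r [] = ([], r, [⟨none, false⟩])) ∨
    ∃ v, ∀ k, ∃ r' b L, requesterTurn Y y k T r []
      = (DictOp.insert k v :: L, r', [⟨some (DPMessage.key k), b⟩]) ∧
        ((L = [] ∧ b = false) ∨ L = [DictOp.delete k]) := by
  cases T with
  | zero => exact Or.inl fun k => rfl
  | succ T =>
    simp only [requesterTurn]
    cases Y.next y r with
    | halt => exact Or.inl fun k => rfl
    | initiate x =>
      cases x with
      | value v =>
        refine Or.inr (Or.inr ⟨v, fun k => ?_⟩)
        obtain ⟨b', h1, h2⟩ := requesterTurn_completed Y y k T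
          (ReqEvent.output (DPMessage.key k) :: r) false
        refine ⟨_, b', _, Prod.ext rfl (Prod.ext rfl h1), ?_⟩
        exact h2
      | key j => exact Or.inr (Or.inl fun k => rfl)
      | insert v => exact Or.inr (Or.inl fun k => rfl)
      | delete j => exact Or.inr (Or.inl fun k => rfl)
    | delete i => exact Or.inl fun k => rfl

theorem requesterTurn_ne_nil (Y : Requester (DPMessage V n)) (y : Y.Coins) (k : Key n) (T : ℕ)
    (r : List (ReqEvent (DPMessage V n))) {l : List (Instance (DPMessage V n))} (hl : l ≠ []) :
    (requesterTurn Y y k T r l).2.2 ≠ [] := by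
  cases T with
  | zero => exact hl
  | succ T =>
    obtain ⟨a, l, rfl⟩ := List.exists_cons_of_ne_nil hl
    simp only [requesterTurn]
    cases Y.next y r with
    | halt => exact hl
    | initiate x => exact hl
    | delete i =>
      simp only
      split
      · simp
      · simp
      · exact hl

theorem withVisitor_weave (Y : Requester (DPMessage V n)) (y : Y.Coins) (k : Key n) (T : ℕ)
    (es : List (EnvStep V n)) (r : List (ReqEvent (DPMessage V n))) :
    WithVisitor k (envOps es) ((weave Y y k T es r []).1 ++
        terminateOps (weave Y y k T es r []).2) := by
  induction es generalizing r with
  | nil => exact WithVisitor.absent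
  | cons e es ih =>
    cases e with
    | inl o => exact (ih r).append_left o
    | inr w =>
      rcases requesterTurn_nil Y y T (ReqEvent.woken w :: r) with h | h | ⟨v, h⟩
      · simp only [weave, h k]
        exact ih _
      · simp only [weave, h k, weave_failed, terminateOps, List.append_nil, List.nil_append]
        exact WithVisitor.absent
      · obtain ⟨r', b, L, h1, h2⟩ := h k
        obtain ⟨h3, h4⟩ := weave_completed Y y k T es r' b
        simp only [weave, h1, List.cons_append, List.append_assoc]
        refine WithVisitor.present [] (envOps es) v _ rfl ?_ ?_
        · rcases h2 with ⟨rfl, -⟩ | rfl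
          · exact h3
          · exact h3.pad
        · rcases h2 with ⟨rfl, rfl⟩ | rfl
          · exact h4 rfl
          · exact List.mem_cons_self

theorem weave_silent (y : (Requester.silent (DPMessage V n)).Coins) (k : Key n) (T : ℕ) (es : List (EnvStep V n))
    (r : List (ReqEvent (DPMessage V n))) :
    weave (Requester.silent (DPMessage V n)) y k T es r [] = (envOps es, []) := by
  induction es generalizing r with
  | nil => rfl
  | cons e es ih =>
    cases e with
    | inl o =>
      simp only [weave, ih]
      rfl
    | inr w =>
      have h : requesterTurn (Requester.silent (DPMessage V n)) y k T (ReqEvent.woken w :: r) []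
          = ([], ReqEvent.woken w :: r, []) := by cases T <;> rfl
      simp only [weave, h, ih]
      rfl

end Script

/-! ### Choosing all keys in advance -/

section Execution

theorem monad_bind_eq {α β : Type} (p : PMF α) (f : α → PMF β) : p >>= f = p.bind f := rfl

theorem monad_pure_eq {α : Type} (a : α) : (pure a : PMF α) = PMF.pure a := rfl

variable {V : Type} {n : ℕ}

/-- The collector `C` runs the protocols of the summarizing collector and executes `step` on the
operations that result. -/
structure Executes (C : DataCollector (DPMessage V n))
    (step : DictOp (Key n) V → C.State → PMF C.State) : Prop where
  mainProtocol_eq : C.mainProtocol = dpMainProtocol V n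
  deletionProtocol_eq : C.deletionProtocol = dpDeletionProtocol V n
  token_eq : C.token = fun _ a => a
  idle_eq : ∀ s, C.idle s = PMF.pure s
  handle_insert : ∀ v s, C.handle (DPMessage.insert v) s =
    (PMF.uniformOfFintype (Key n)).bind fun k => (step (DictOp.insert k v) s).bind fun s' =>
      PMF.pure (s', some (DPMessage.key k))
  handle_delete : ∀ k s, C.handle (DPMessage.delete k) s =
    (step (DictOp.delete k) s).bind fun s' => PMF.pure (s', none)

variable {C : DataCollector (DPMessage V n)} {step : DictOp (Key n) V → C.State → PMF C.State}

theorem Executes.serve_value (h : Executes C step) (v : V) (s : C.State) :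
    C.serve C.mainProtocol (DPMessage.value v) s
      = (PMF.uniformOfFintype (Key n)).bind fun k => (step (DictOp.insert k v) s).bind fun s' =>
          PMF.pure (s', some (DPMessage.key k)) := by
  simp only [DataCollector.serve, h.mainProtocol_eq, dpMainProtocol, h.handle_insert,
    monad_bind_eq, monad_pure_eq, PMF.bind_bind, PMF.pure_bind, Option.map_some, id]

theorem Executes.serve_key (h : Executes C step) (k : Key n) (s : C.State) :
    C.serve C.deletionProtocol (DPMessage.key k) s
      = (step (DictOp.delete k) s).bind fun s' => PMF.pure (s', none) := by
  simp only [DataCollector.serve, h.deletionProtocol_eq, dpDeletionProtocol, h.handle_delete,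
    monad_bind_eq, monad_pure_eq, PMF.bind_bind, PMF.pure_bind, Option.map_none]

theorem Executes.serve_main_of_ne (h : Executes C step) {m : DPMessage V n}
    (hm : ∀ v, m ≠ DPMessage.value v) (s : C.State) :
    C.serve C.mainProtocol m s = PMF.pure (s, none) := by
  cases m with
  | value v => exact absurd rfl (hm v)
  | _ => simp only [DataCollector.serve, h.mainProtocol_eq, dpMainProtocol, monad_pure_eq]

theorem Executes.serve_deletion_of_ne (h : Executes C step) {m : DPMessage V n}
    (hm : ∀ k, m ≠ DPMessage.key k) (s : C.State) :
    C.serve C.deletionProtocol m s = PMF.pure (s, none) := by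
  cases m with
  | key k => exact absurd rfl (hm k)
  | _ => simp only [DataCollector.serve, h.deletionProtocol_eq, dpDeletionProtocol, monad_pure_eq]

theorem Executes.runHonest_value (h : Executes C step) (v : V) (s : C.State) :
    C.runHonest C.mainProtocol (DPMessage.value v) s
      = (PMF.uniformOfFintype (Key n)).bind fun k => (step (DictOp.insert k v) s).bind fun s' =>
          PMF.pure (s', some (DPMessage.value v, DPMessage.key k)) := by
  have hs : C.mainProtocol.clientSend (DPMessage.value v) = some (DPMessage.value v) := by
    rw [h.mainProtocol_eq]
    rfl
  simp only [DataCollector.runHonest, hs, h.serve_value, monad_bind_eq, monad_pure_eq,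
    PMF.bind_bind, PMF.pure_bind, Option.map_some]

theorem Executes.runHonest_key (h : Executes C step) (k : Key n) (s : C.State) :
    C.runHonest C.deletionProtocol (DPMessage.key k) s
      = (step (DictOp.delete k) s).bind fun s' => PMF.pure (s', none) := by
  have hs : C.deletionProtocol.clientSend (DPMessage.key k) = some (DPMessage.key k) := by
    rw [h.deletionProtocol_eq]
    rfl
  simp only [DataCollector.runHonest, hs, h.serve_key, monad_bind_eq, monad_pure_eq,
    PMF.bind_bind, PMF.pure_bind, Option.map_none]

theorem Executes.runHonest_main_of_ne (h : Executes C step) {m : DPMessage V n}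
    (hm : ∀ v, m ≠ DPMessage.value v) (s : C.State) :
    C.runHonest C.mainProtocol m s = PMF.pure (s, none) := by
  cases m with
  | value v => exact absurd rfl (hm v)
  | _ => simp only [DataCollector.runHonest, h.mainProtocol_eq, dpMainProtocol, monad_pure_eq]

theorem Executes.runHonest_deletion_of_ne (h : Executes C step) {m : DPMessage V n}
    (hm : ∀ k, m ≠ DPMessage.key k) (s : C.State) :
    C.runHonest C.deletionProtocol m s = PMF.pure (s, none) := by
  cases m with
  | key k => exact absurd rfl (hm k)
  | _ => simp only [DataCollector.runHonest, h.deletionProtocol_eq, dpDeletionProtocol,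
      monad_pure_eq]

theorem Executes.terminate_eq (h : Executes C step) (l : List (Instance (DPMessage V n)))
    (s : C.State) : C.terminate l s = runOps step (terminateOps l) s := by
  induction l generalizing s with
  | nil => rfl
  | cons a l ih =>
    obtain ⟨_ | t, _ | _⟩ := a
    · simpa only [DataCollector.terminate, terminateOps] using ih s
    · simpa only [DataCollector.terminate, terminateOps] using ih s
    · cases t with
      | key k =>
        simp only [DataCollector.terminate, terminateOps, h.runHonest_key, monad_bind_eq, runOps,
          PMF.bind_bind, PMF.pure_bind]
        congr 1
        funext s'
        exact ih s'
      | _ =>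
        simp only [DataCollector.terminate, terminateOps, monad_bind_eq]
        rw [h.runHonest_deletion_of_ne (by simp), PMF.pure_bind]
        exact ih s
    · cases t <;> simpa only [DataCollector.terminate, terminateOps] using ih s

/-- Consecutive activations of the deletion-requester, with the key of its first instance chosen in
advance. -/
theorem Executes.runRequester_eq (h : Executes C step) (Y : Requester (DPMessage V n)) (y : Y.Coins) (T : ℕ)
    (c : Config C) (κ : PMF (Key n))
    (hκ : c.instances = [] → κ = PMF.uniformOfFintype (Key n))
    (hrep : ∀ c' ∈ (C.runRequester Y y T c).support,
      c'.instances.length ≤ 1) :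
    C.runRequester Y y T c = κ.bind fun k =>
      (runOps step (requesterTurn Y y k T c.reqLog c.instances).1 c.state).bind fun s =>
        PMF.pure { c with
          state := s
          reqLog := (requesterTurn Y y k T c.reqLog c.instances).2.1
          instances := (requesterTurn Y y k T c.reqLog c.instances).2.2 } := by
  induction T generalizing c κ with
  | zero =>
    simp only [DataCollector.runRequester, requesterTurn, runOps, PMF.pure_bind, PMF.bind_const,
      monad_pure_eq]
  | succ T ih =>
    cases hY : Y.next y c.reqLog with
    | halt =>
      simp only [DataCollector.runRequester, requesterTurn, hY, runOps, PMF.pure_bind,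
        PMF.bind_const, monad_pure_eq]
    | delete i =>
      simp only [DataCollector.runRequester, requesterTurn, hY]
      rcases hi : c.instances[i]? with _ | ⟨_ | t, b⟩
      · simp only [runOps, PMF.pure_bind, PMF.bind_const, monad_pure_eq]
      · simp only [runOps, PMF.pure_bind, PMF.bind_const, monad_pure_eq]
      · cases t with
        | key k =>
          simp only [h.runHonest_key, runOps, PMF.bind_bind, PMF.pure_bind, PMF.bind_const,
            monad_bind_eq, monad_pure_eq]
        | _ =>
          simp only [runOps, PMF.pure_bind, PMF.bind_const, monad_bind_eq, monad_pure_eq]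
          rw [h.runHonest_deletion_of_ne (by simp), PMF.pure_bind]
    | initiate x =>
      -- Were there an instance already, this initiation would lead to a possible configuration with
      -- two.
      have hnil : c.instances = [] := by
        obtain ⟨c', hc', hlen⟩ := exists_mem_support_of_initiate _ Y y T c hY
        have := hrep c' hc'
        exact List.eq_nil_of_length_eq_zero (by omega)
      rw [hκ hnil]
      cases x with
      | value v =>
        have hout : C.mainProtocol.clientOutput = id := by
          rw [h.mainProtocol_eq]
          rfl
        simp only [DataCollector.runRequester, requesterTurn, hY, hnil, h.runHonest_value, hout,
          h.token_eq, monad_bind_eq, PMF.bind_bind, PMF.pure_bind, runOps, List.nil_append,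
          id] at hrep ⊢
        congr 1
        funext k
        refine bind_congr_support fun s hs => ?_
        have hsupp : ∀ c', c' ∈ (C.runRequester Y y T
            { c with
              state := s
              reqLog := ReqEvent.output (DPMessage.key k) :: c.reqLog
              instances := [⟨some (DPMessage.key k), false⟩] }).support →
            c'.instances.length ≤ 1 := by
          intro c' hc'
          refine hrep c' ?_
          rw [PMF.mem_support_bind_iff]
          refine ⟨k, PMF.mem_support_uniformOfFintype k, ?_⟩
          rw [PMF.mem_support_bind_iff]
          exact ⟨s, hs, hc'⟩
        -- From now on the key of the requester is the one just drawn; the general law `κ` in the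
        -- statement serves to allow this in the induction.
        have := ih _ (PMF.pure k) (fun h => by simp at h) hsupp
        rw [PMF.pure_bind] at this
        exact this
      | _ =>
        simp only [DataCollector.runRequester, requesterTurn, hY, hnil, runOps, PMF.pure_bind,
          PMF.bind_const, monad_bind_eq, monad_pure_eq]
        rw [h.runHonest_main_of_ne (by simp), PMF.pure_bind, List.nil_append]

/-- The alive phase, with all keys chosen in advance. -/
theorem Executes.runAlive_eq (h : Executes C step) (Z : Environment (DPMessage V n)) (z : Z.Coins)
    (Y : Requester (DPMessage V n)) (y : Y.Coins) (T k : ℕ)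
    (c : Config C) (κ : PMF (Key n))
    (hκ : c.instances = [] → κ = PMF.uniformOfFintype (Key n))
    (hrep : ∀ c' ∈ (C.runAlive Z z Y y T k c).support,
      c'.instances.length ≤ 1) :
    (C.runAlive Z z Y y T k c).bind
        (fun c' => PMF.pure (c'.state, c'.envLog, c'.instances))
      = (keyTape n k).bind fun ks => κ.bind fun key =>
        (runOps step
          (weave Y y key T (envScript Z z ks c.envLog c.sessions).1 c.reqLog c.instances).1
          c.state).bind fun s => PMF.pure (s, (envScript Z z ks c.envLog c.sessions).2,
            (weave Y y key T (envScript Z z ks c.envLog c.sessions).1 c.reqLog c.instances).2) := by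
  induction k generalizing c κ with
  | zero =>
    simp only [DataCollector.runAlive, keyTape, PMF.pure_bind, monad_pure_eq, envScript, weave,
      runOps, PMF.bind_const]
  | succ k ih =>
    cases hZ : Z.next z c.envLog with
    | endAlive =>
      simp only [DataCollector.runAlive, hZ, keyTape, PMF.pure_bind, monad_pure_eq, envScript,
        weave, runOps, PMF.bind_const, PMF.bind_bind]
    | openSession κ' =>
      simp only [DataCollector.runAlive, hZ] at hrep
      simp only [DataCollector.runAlive, hZ, keyTape, PMF.bind_bind, PMF.pure_bind, envScript,
        PMF.bind_const]
      exact ih _ κ hκ hrep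
    | wakeCollector =>
      simp only [DataCollector.runAlive, hZ, monad_bind_eq] at hrep
      simp only [DataCollector.runAlive, hZ, keyTape, PMF.bind_bind, PMF.pure_bind, envScript,
        PMF.bind_const, monad_bind_eq]
      rw [h.idle_eq, PMF.pure_bind] at hrep ⊢
      exact ih _ κ hκ hrep
    | wakeRequester w =>
      simp only [DataCollector.runAlive, hZ, monad_bind_eq] at hrep
      simp only [DataCollector.runAlive, hZ, keyTape, PMF.bind_bind, PMF.pure_bind, envScript,
        PMF.bind_const, monad_bind_eq, weave]
      set c₀ : Config C :=
        { c with reqLog := ReqEvent.woken w :: c.reqLog } with hc₀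
      have hrep₀ : ∀ c' ∈ (C.runRequester Y y T c₀).support,
          c'.instances.length ≤ 1 := by
        intro c₁ hc₁
        obtain ⟨c₂, hc₂⟩ := (C.runAlive Z z Y y T k
          { c₁ with envLog := EnvEvent.silent :: c₁.envLog }).support_nonempty
        refine le_trans ?_ (hrep c₂ ((PMF.mem_support_bind_iff _ _ _).mpr ⟨c₁, hc₁, hc₂⟩))
        exact runAlive_invariant _ Z z Y y T
          (c := { c₁ with envLog := EnvEvent.silent :: c₁.envLog }) (fun l => c₁.instances.length ≤ l.length)
          (fun c h c' hc' => h.trans (length_le_of_mem_support_runRequester _ Y y hc'))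
          le_rfl hc₂
      have hreq := h.runRequester_eq Y y T c₀ κ hκ hrep₀
      -- Whether the requester remains without an instance in this turn does not depend on its key.
      -- If it does, the key is still unused and `κ` is kept; if not, there is an instance for every
      -- key, and the induction continues with the key fixed.
      by_cases hinactive : c.instances = [] ∧ ∀ key, requesterTurn Y y key T c₀.reqLog []
          = ([], c₀.reqLog, [])
      · obtain ⟨hnil, hturn⟩ := hinactive
        have hpure : C.runRequester Y y T c₀ = PMF.pure c₀ := by
          have hnil₀ : c₀.instances = [] := hnil
          simp only [hreq, hnil₀, hturn, runOps, PMF.pure_bind, PMF.bind_const]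
          rw [← hnil₀]
        rw [hpure, PMF.pure_bind] at hrep ⊢
        have := ih { c₀ with envLog := EnvEvent.silent :: c₀.envLog } κ hκ hrep
        have hnil₀ : c₀.instances = [] := hnil
        simp only [hnil, hnil₀] at this ⊢
        change ∀ key, requesterTurn Y y key T (ReqEvent.woken w :: c.reqLog) [] = _ at hturn
        simp only [hturn, List.nil_append]
        exact this
      · have hne : ∀ key, (requesterTurn Y y key T c₀.reqLog c₀.instances).2.2 ≠ [] := by
          intro key
          by_cases hnil : c.instances = []
          · change (requesterTurn Y y key T c₀.reqLog c.instances).2.2 ≠ []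
            rw [hnil]
            rcases requesterTurn_nil Y y T c₀.reqLog with h | h | ⟨v, h⟩
            · exact absurd ⟨hnil, h⟩ hinactive
            · simp [h]
            · obtain ⟨r', b, L, h1, -⟩ := h key
              simp [h1]
          · exact requesterTurn_ne_nil Y y key T c₀.reqLog hnil
        rw [hreq] at hrep ⊢
        simp only [PMF.bind_bind, PMF.pure_bind, runOps_append] at hrep ⊢
        -- The requester's key is moved in front of the remaining tape, in the order in which the
        -- execution uses them.
        rw [PMF.bind_comm (keyTape n k) κ]
        refine bind_congr_support fun key hkey => ?_
        rw [PMF.bind_comm (keyTape n k)]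
        refine bind_congr_support fun s hs => ?_
        have := ih
          { c₀ with
            state := s
            envLog := EnvEvent.silent :: c₀.envLog
            reqLog := (requesterTurn Y y key T c₀.reqLog c₀.instances).2.1
            instances := (requesterTurn Y y key T c₀.reqLog c₀.instances).2.2 }
          (PMF.pure key) (fun h => absurd h (hne key)) fun c' hc' => hrep c' <| by
            rw [PMF.mem_support_bind_iff]
            refine ⟨key, hkey, ?_⟩
            rw [PMF.mem_support_bind_iff]
            exact ⟨s, hs, hc'⟩
        simp only [PMF.pure_bind] at this
        exact this
    | send i m =>
      simp only [DataCollector.runAlive, hZ] at hrep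
      simp only [DataCollector.runAlive, hZ, keyTape, PMF.bind_bind, PMF.pure_bind, envScript]
      rcases hi : c.sessions[i]? with _ | ⟨κ', _ | _⟩
      · simp only [hi, PMF.bind_const] at hrep ⊢
        exact ih _ κ hκ hrep
      · cases κ' with
        | main =>
          simp only [hi, DataCollector.protocol] at hrep ⊢
          cases m with
          | value v =>
            simp only [h.serve_value, monad_bind_eq, PMF.bind_bind, PMF.pure_bind, weave,
              runOps] at hrep ⊢
            refine bind_congr_support fun key' hkey' => ?_
            calc _ = (step (DictOp.insert key' v) c.state).bind fun s => _ :=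
                  bind_congr_support fun s hs => ih
                    { c with
                      state := s
                      envLog := EnvEvent.received i (DPMessage.key key') :: c.envLog
                      sessions := c.sessions.set i (Kind.main, true) } κ hκ
                    fun c' hc' => hrep c' <| by
                      rw [PMF.mem_support_bind_iff]
                      refine ⟨key', hkey', ?_⟩
                      rw [PMF.mem_support_bind_iff]
                      exact ⟨s, hs, hc'⟩
              _ = _ := by
                rw [PMF.bind_comm]
                congr 1
                funext ks
                rw [PMF.bind_comm]
          | _ =>
            rw [h.serve_main_of_ne (by simp)] at hrep ⊢
            simp only [monad_bind_eq, PMF.pure_bind, PMF.bind_const] at hrep ⊢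
            exact ih
              { c with
                envLog := EnvEvent.silent :: c.envLog
                sessions := c.sessions.set i (Kind.main, true) } κ hκ hrep
        | deletion =>
          simp only [hi, DataCollector.protocol] at hrep ⊢
          cases m with
          | key j =>
            simp only [h.serve_key, monad_bind_eq, PMF.bind_bind, PMF.pure_bind, weave,
              runOps, PMF.bind_const] at hrep ⊢
            calc _ = (step (DictOp.delete j) c.state).bind fun s => _ :=
                  bind_congr_support fun s hs => ih
                    { c with
                      state := s
                      envLog := EnvEvent.silent :: c.envLog
                      sessions := c.sessions.set i (Kind.deletion, true) } κ hκ
                    fun c' hc' => hrep c' <| by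
                      rw [PMF.mem_support_bind_iff]
                      exact ⟨s, hs, hc'⟩
              _ = _ := by
                rw [PMF.bind_comm]
                congr 1
                funext ks
                rw [PMF.bind_comm]
          | _ =>
            rw [h.serve_deletion_of_ne (by simp)] at hrep ⊢
            simp only [monad_bind_eq, PMF.pure_bind, PMF.bind_const] at hrep ⊢
            exact ih
              { c with
                envLog := EnvEvent.silent :: c.envLog
                sessions := c.sessions.set i (Kind.deletion, true) } κ hκ hrep
      · simp only [hi, PMF.bind_const] at hrep ⊢
        exact ih _ κ hκ hrep

/-- The operations executed by the collector in the complete execution. -/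
def allOps (Z : Environment (DPMessage V n)) (z : Z.Coins) (Y : Requester (DPMessage V n))
    (y : Y.Coins) (T : ℕ) (ks : List (Key n)) (key : Key n) : List (DictOp (Key n) V) :=
  (weave Y y key T (envScript Z z ks [] []).1 [] []).1 ++
    terminateOps (weave Y y key T (envScript Z z ks [] []).1 [] []).2

/-- The complete execution, with all keys chosen in advance. -/
theorem Executes.exec_eq (h : Executes C step) (Z : Environment (DPMessage V n))
    (Y : Requester (DPMessage V n)) (T : ℕ) (hY : C.IsRepresentative 1 Y T) :
    C.exec Z Y T = Z.coins.bind fun z => Y.coins.bind fun y => C.start.bind fun s =>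
      (keyTape n T).bind fun ks => (PMF.uniformOfFintype (Key n)).bind fun key =>
        (runOps step (allOps Z z Y y T ks key) s).bind fun s' =>
          PMF.pure (s', (z, (envScript Z z ks [] []).2)) := by
  have hY' := hY Z
  simp only [DataCollector.exec, DataCollector.run, PMF.map, monad_bind_eq, monad_pure_eq,
    PMF.bind_bind, PMF.pure_bind, Function.comp_apply, h.terminate_eq] at hY' ⊢
  refine bind_congr_support fun z hz => bind_congr_support fun y hy =>
    bind_congr_support fun s hs => ?_
  have halive := h.runAlive_eq Z z Y y T T ⟨s, [], [], [], []⟩ _ (fun _ => rfl) (by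
    intro c hc
    -- Being representative concerns complete executions. The terminate phase leaves the list of
    -- instances unchanged and has a possible outcome, so the bound carries over to the end of the
    -- alive phase.
    obtain ⟨s', hs'⟩ := (runOps step (terminateOps c.instances) c.state).support_nonempty
    refine hY' (z, { c with state := s' }) ?_
    simp only [PMF.mem_support_bind_iff]
    exact ⟨z, hz, y, hy, s, hs, c, hc, s', hs', (PMF.mem_support_pure_iff _ _).mpr rfl⟩)
  have hbind := congrArg (fun P => PMF.bind P fun r =>
    (runOps step (terminateOps r.2.2) r.1).bind fun s' => PMF.pure (s', (z, r.2.1))) halive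
  simp only [PMF.bind_bind, PMF.pure_bind] at hbind
  simp only [allOps, runOps_append, PMF.bind_bind]
  exact hbind

/-- The initial state is independent of coins and keys. Averaging over it last leaves a fixed list
of operations inside, and the view of `Z` is a constant there. -/
theorem Executes.expect_exec (h : Executes C step) (Z : Environment (DPMessage V n))
    (Y : Requester (DPMessage V n)) (T : ℕ) (hY : C.IsRepresentative 1 Y T)
    (f : C.State × (Z.Coins × List (EnvEvent (DPMessage V n))) → ℝ≥0∞) :
    expect (C.exec Z Y T) f
      = expect Z.coins fun z => expect Y.coins fun y => expect (keyTape n T) fun ks =>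
        expect (PMF.uniformOfFintype (Key n)) fun key => expect C.start fun s =>
          expect (runOps step (allOps Z z Y y T ks key) s) fun s' =>
            f (s', (z, (envScript Z z ks [] []).2)) := by
  rw [h.exec_eq Z Y T hY]
  simp only [expect_bind, expect_pure]
  congr 1
  funext z
  congr 1
  funext y
  rw [expect_comm]
  congr 1
  funext ks
  rw [expect_comm]

end Execution

/-! ### The compliance error of the summarizing collector -/

section ComplianceError

variable {V Out : Type} {n : ℕ+}

theorem nonempty_thresholds (n : ℕ+) : (Finset.Icc ((n : ℕ) + 1) (2 * (n : ℕ))).Nonempty :=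
  Finset.nonempty_Icc.mpr (by have := n.pos; omega)

theorem executes_dpCollector (summarize : (k : ℕ) → (Fin k → V) → PMF Out)
    (I : DictImpl (Key n) V) :
    Executes (dpCollector summarize n I) (collectorStep summarize I) where
  mainProtocol_eq := rfl
  deletionProtocol_eq := rfl
  token_eq := rfl
  idle_eq _ := rfl
  handle_insert v s := dpInsert_eq summarize I v s
  handle_delete k s := dpDelete_eq summarize I k s

/-- The expectation of `g` in the final state, after a sequence of operations on the initial state. -/
def finalExpect (summarize : (k : ℕ) → (Fin k → V) → PMF Out) (I : DictImpl (Key n) V)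
    (S : List (DictOp (Key n) V)) (g : DPState I Out → ℝ≥0∞) : ℝ≥0∞ :=
  expect (PMF.uniformOfFinset (Finset.Icc ((n : ℕ) + 1) (2 * (n : ℕ))) (nonempty_thresholds n))
    fun θ => expect (stateLaw summarize (memoryLaw I S) (entryCount (dictAfter (fun _ => none) S)) θ
      (firstHit θ (fun _ => none) S)) g

theorem expect_start (summarize : (k : ℕ) → (Fin k → V) → PMF Out) {I : DictImpl (Key n) V}
    (hI : I.IsDictionary) (S : List (DictOp (Key n) V)) (g : DPState I Out → ℝ≥0∞) :
    expect (dpCollector summarize n I).start (fun s =>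
      expect (runOps (collectorStep summarize I) S s) g) = finalExpect summarize I S g := by
  change expect (I.start.bind fun m =>
    (PMF.uniformOfFinset (Finset.Icc ((n : ℕ) + 1) (2 * (n : ℕ))) (nonempty_thresholds n)).bind
      fun θ => PMF.pure (⟨m, θ, 0, false, none⟩ : DPState I Out))
    (fun s : DPState I Out => expect (runOps (collectorStep summarize I) S s) g) = _
  rw [PMF.bind_comm]
  simp only [expect_bind, expect_pure]
  refine expect_congr_support fun θ hθ => ?_
  rw [PMF.mem_support_uniformOfFinset_iff, Finset.mem_Icc] at hθ
  rw [← start_bind_runOps summarize hI (show 0 < θ by omega), expect_bind]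

theorem expect_exec (summarize : (k : ℕ) → (Fin k → V) → PMF Out) {I : DictImpl (Key n) V}
    (hI : I.IsDictionary) (Z : Environment (DPMessage V n)) (Y : Requester (DPMessage V n)) (T : ℕ)
    (hY : (dpCollector summarize n I).IsRepresentative 1 Y T)
    (f : DPState I Out × (Z.Coins × List (EnvEvent (DPMessage V n))) → ℝ≥0∞) :
    expect ((dpCollector summarize n I).exec Z Y T) f
      = expect Z.coins fun z => expect Y.coins fun y => expect (keyTape n T) fun ks =>
        expect (PMF.uniformOfFintype (Key n)) fun key =>
          finalExpect summarize I (allOps Z z Y y T ks key) fun s =>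
            f (s, (z, (envScript Z z ks [] []).2)) := by
  refine ((executes_dpCollector summarize I).expect_exec Z Y T hY f).trans ?_
  congr 1
  funext z
  congr 1
  funext y
  congr 1
  funext ks
  congr 1
  funext key
  exact expect_start summarize hI _ _

/-- The keys used by few operations are hit by a random key with small probability. -/
theorem expect_target (S : List (DictOp (Key n) V)) :
    expect (PMF.uniformOfFintype (Key n)) (fun k => if ∀ o ∈ S, o.target ≠ k then 0 else 1)
      ≤ (S.length : ℝ≥0∞) / 2 ^ (n : ℕ) := by
  classical
  rw [expect_uniformOfFintype, ENNReal.div_eq_inv_mul]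
  have hcard : (Fintype.card (Key n) : ℝ≥0∞) = 2 ^ (n : ℕ) := by simp
  rw [hcard]
  gcongr
  calc ∑ k : Key n, (if ∀ o ∈ S, o.target ≠ k then (0 : ℝ≥0∞) else 1)
      = ((Finset.univ.filter fun k : Key n => ¬ ∀ o ∈ S, o.target ≠ k).card : ℝ≥0∞) := by
        rw [Finset.card_eq_sum_ones, Finset.sum_filter]
        push_cast
        refine Finset.sum_congr rfl fun k _ => ?_
        split_ifs <;> simp_all
    _ ≤ ((S.map DictOp.target).toFinset.card : ℝ≥0∞) := by
        gcongr
        intro k hk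
        rw [Finset.mem_filter] at hk
        have h := hk.2
        push Not at h
        obtain ⟨o, ho, rfl⟩ := h
        exact List.mem_toFinset.mpr (List.mem_map_of_mem ho)
    _ ≤ (S.length : ℝ≥0∞) := by
        gcongr
        exact (List.toFinset_card_le _).trans (List.length_map _).le

theorem expect_exec_le {summarize : (k : ℕ) → (Fin k → V) → PMF Out} {ε : ℕ → ℝ}
    (hA : IsDifferentiallyPrivate summarize ε) (hε : 0 ≤ ε n) {I : DictImpl (Key n) V}
    (hI : I.IsDictionary) (hH : I.HistoryIndependent) (Z : Environment (DPMessage V n))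
    (Y : Requester (DPMessage V n)) (T : ℕ)
    (hY : (dpCollector summarize n I).IsRepresentative 1 Y T)
    {f : DPState I Out × (Z.Coins × List (EnvEvent (DPMessage V n))) → ℝ≥0∞}
    (hf : ∀ a, f a ≤ 1) :
    expect ((dpCollector summarize n I).exec Z Y T) f
      ≤ expect ((dpCollector summarize n I).exec Z (Requester.silent _) T) f
        + (ENNReal.ofReal (ε n) + ((n : ℕ) : ℝ≥0∞)⁻¹ + (T : ℝ≥0∞) / 2 ^ (n : ℕ)) := by
  classical
  set δ := ENNReal.ofReal (ε n) + ((n : ℕ) : ℝ≥0∞)⁻¹ with hδ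
  rw [expect_exec summarize hI Z Y T hY,
    expect_exec summarize hI Z _ T (isRepresentative_silent _ 1 T)]
  -- The ideal operations depend neither on the requester's coins nor on its key, so both averages
  -- disappear on that side and the key is independent of `S`.
  have hideal : ∀ z (y : (Requester.silent (DPMessage V n)).Coins) ks key,
      allOps Z z (Requester.silent _) y T ks key = envOps (envScript Z z ks [] []).1 := by
    intro z y ks key
    rw [allOps, weave_silent]
    exact List.append_nil _
  simp only [hideal, expect_const]
  rw [← expect_const Z.coins (δ + (T : ℝ≥0∞) / 2 ^ (n : ℕ)), ← expect_add]
  refine expect_mono fun z => ?_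
  rw [← expect_const Y.coins (expect (keyTape n T) _ + (δ + (T : ℝ≥0∞) / 2 ^ (n : ℕ)))]
  refine expect_mono fun y => ?_
  rw [← expect_const (keyTape n T) (δ + (T : ℝ≥0∞) / 2 ^ (n : ℕ)), ← expect_add]
  refine expect_mono_support fun ks hks => ?_
  set S := envOps (envScript Z z ks [] []).1 with hS
  have hlen : S.length ≤ T := (List.length_filterMap_le _ _).trans
    ((length_envScript Z z ks [] []).trans (length_of_mem_support_keyTape hks).le)
  calc _ ≤ expect (PMF.uniformOfFintype (Key n)) (fun key =>
        (finalExpect summarize I S (fun s => f (s, (z, (envScript Z z ks [] []).2))) + δ)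
          + (if ∀ o ∈ S, o.target ≠ key then 0 else 1)) := by
        refine expect_mono fun key => ?_
        split_ifs with h
        · rw [add_zero]
          exact (withVisitor_weave Y y key T _ []).expect_le hA hε n.pos hH h (fun _ => hf _)
            (nonempty_thresholds n)
        -- If the requester's key is used by the environment, the trivial bound one is charged to
        -- the indicator.
        · exact (expect_le_one fun θ => expect_le_one fun _ => hf _).trans le_add_self
    _ ≤ _ := by
        rw [expect_add, expect_const, add_assoc]
        refine add_le_add le_rfl (add_le_add le_rfl ((expect_target S).trans ?_))
        gcongr

end ComplianceError

end DeletionCompliance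

end

/-- For every polynomial time bound `q` there is a polynomial `p` such that, for every security
parameter `n`, the collector that uses an `ε`-differentially private summarization mechanism and
history-independent dictionaries has `1`-representative deletion-compliance error at most
`ε(n) + 1/n + p(n)/2^n` against all environments and deletion-requesters with time `q(n)`. -/
theorem theorem3p3 (q : Polynomial ℕ) :
    ∃ p : Polynomial ℕ,
      ∀ (V Out : Type) (summarize : (k : ℕ) → (Fin k → V) → PMF Out) (ε : ℕ → ℝ)
        (dict : (n : ℕ) → DictImpl (Key n) V),
        (∀ n, ε n ∈ Set.Icc (0 : ℝ) 1) →
        IsDifferentiallyPrivate summarize ε →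
        (∀ n, (dict n).IsDictionary) →
        (∀ n, (dict n).HistoryIndependent) →
        ∀ n : ℕ+,
          (dpCollector summarize n (dict n)).complianceError 1 (q.eval (n : ℕ)) ≤
            ε n + 1 / (n : ℝ) + ((p.eval (n : ℕ) : ℕ) : ℝ) / 2 ^ (n : ℕ) := by
  -- The numerator of the collision term bounds the number of operations of the environment, which
  -- is at most its number `q(n)` of activations.
  refine ⟨q, fun V Out summarize ε dict hε hA hI hH n => ?_⟩
  have hn : (0 : ℝ) < (n : ℕ) := Nat.cast_pos.mpr n.pos
  have hδ : 0 ≤ ε n + 1 / (n : ℝ) + ((q.eval (n : ℕ) : ℕ) : ℝ) / 2 ^ (n : ℕ) := by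
    have := (hε n).1
    positivity
  refine Real.sSup_le ?_ hδ
  rintro r ⟨Z, Y, D, hY, rfl⟩
  refine advantage_le hδ (fun f hf => ?_) D
  refine (expect_exec_le hA (hε n).1 (hI n) (hH n) Z Y _ hY hf).trans_eq ?_
  congr 1
  have h0 := (hε n).1
  rw [ENNReal.ofReal_add (by positivity) (by positivity), ENNReal.ofReal_add h0 (by positivity),
    one_div, ENNReal.ofReal_inv_of_pos hn, ENNReal.ofReal_natCast,
    ENNReal.ofReal_div_of_pos (by positivity), ENNReal.ofReal_natCast,
    ENNReal.ofReal_pow (by norm_num), ENNReal.ofReal_ofNat]
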